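/- Let $n\ge 1$, let $\Omega\subset\mathbb{R}^n$ be a bounded domain (a nonempty connected bounded open set; in particular a bounded domain with smooth boundary, but no regularity of the boundary is needed), let $p\in(1,2)\cup(2,\infty)$ and let $p^*$ be given by $1/p+1/p^*=1$. Put $\chi(p)=1$ if $p<2$ and $\chi(p)=0$ if $p>2$. Let $W^{1,p}_0(\Omega)$ be the closure of $C_c^\infty(\Omega)$ in the Sobolev space $W^{1,p}(\Omega)$. Let $f\in L^{p^*}(\Omega)$ have constant sign, that is, either $f>0$ a.e. in $\Omega$ or $f<0$ a.e. in $\Omega$. For $u\in W^{1,p}_0(\Omega)$ and $\epsilon>0$ set $$I[u]=\frac1p\int_\Omega|\nabla u|^p\,dx-\int_\Omega fu\,dx,\qquad I^{(\epsilon)}[u]=\frac1p\int_\Omega\bigl(|\nabla u|^2+\chi(p)\epsilon^2\bigr)^{p/2}dx-\int_\Omega fu\,dx .$$ Then: (i) $I$ has exactly one minimizer $\bar u$ over $W^{1,p}_0(\Omega)$ (up to equality a.e. in $\Omega$), and $\bar u>0$ a.e. in $\Omega$ if $f>0$, while $\bar u<0$ a.e. in $\Omega$ if $f<0$. (ii)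 For every $\epsilon>0$ there is a minimizer $\bar u_\epsilon$ of $I^{(\epsilon)}$ over $W^{1,p}_0(\Omega)$ such that $\bar u_\epsilon\ge 0$ a.e. in $\Omega$ if $f>0$, $\bar u_\epsilon\le 0$ a.e. in $\Omega$ if $f<0$, and the family $(\bar u_\epsilon)_{\epsilon>0}$ satisfies $\bar u_\epsilon\to\bar u$ strongly in $W^{1,p}_0(\Omega)$ as $\epsilon\to0^+$. -/

import Mathlib

open MeasureTheory Filter Topology
open scoped ENNReal Distributions

noncomputable section

namespace PLaplace

variable {n : ℕ}

/-- `G` is a weak (distributional) gradient of `u` in the open set `Ω`: both are locally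
integrable in `Ω` and, for every `φ ∈ C_c^∞(Ω)` and every direction `v`,
`∫_Ω u ∂_v φ dx = - ∫_Ω φ (G · v) dx`. -/
def HasWeakGradient (Ω : TopologicalSpace.Opens (EuclideanSpace ℝ (Fin n)))
    (u : EuclideanSpace ℝ (Fin n) → ℝ)
    (G : EuclideanSpace ℝ (Fin n) → EuclideanSpace ℝ (Fin n)) : Prop :=
  LocallyIntegrableOn u (Ω : Set (EuclideanSpace ℝ (Fin n))) volume ∧
  LocallyIntegrableOn G (Ω : Set (EuclideanSpace ℝ (Fin n))) volume ∧
  ∀ (φ : 𝓓(Ω, ℝ)) (v : EuclideanSpace ℝ (Fin n)),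
    ∫ x in Ω, u x * fderiv ℝ φ x v = - ∫ x in Ω, φ x * inner ℝ (G x) v

open Classical in
/-- The weak gradient `∇u` in `Ω`, unique almost everywhere in `Ω` when it exists;
by convention `0` when `u` has no weak gradient. -/
def weakGrad (Ω : TopologicalSpace.Opens (EuclideanSpace ℝ (Fin n)))
    (u : EuclideanSpace ℝ (Fin n) → ℝ) :
    EuclideanSpace ℝ (Fin n) → EuclideanSpace ℝ (Fin n) :=
  if h : ∃ G, HasWeakGradient Ω u G then h.choose else 0

/-- The Sobolev space `W^{1,p}(Ω)`. Its members are represented by functions on `ℝⁿ`, of which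
only the values almost everywhere in `Ω` matter. -/
def W1p (Ω : TopologicalSpace.Opens (EuclideanSpace ℝ (Fin n))) (p : ℝ) :
    Set (EuclideanSpace ℝ (Fin n) → ℝ) :=
  {u | MemLp u (ENNReal.ofReal p) (volume.restrict Ω) ∧
    (∃ G, HasWeakGradient Ω u G) ∧
    MemLp (weakGrad Ω u) (ENNReal.ofReal p) (volume.restrict Ω)}

/-- The norm `‖u‖_{L^p(Ω)} + ‖∇u‖_{L^p(Ω)}` of `W^{1,p}(Ω)`, as an extended nonnegative real. -/
def W1pNorm (Ω : TopologicalSpace.Opens (EuclideanSpace ℝ (Fin n))) (p : ℝ)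
    (u : EuclideanSpace ℝ (Fin n) → ℝ) : ℝ≥0∞ :=
  eLpNorm u (ENNReal.ofReal p) (volume.restrict Ω) +
    eLpNorm (weakGrad Ω u) (ENNReal.ofReal p) (volume.restrict Ω)

/-- `W₀^{1,p}(Ω)`: the closure of `C_c^∞(Ω)` in `W^{1,p}(Ω)`. -/
def W01p (Ω : TopologicalSpace.Opens (EuclideanSpace ℝ (Fin n))) (p : ℝ) :
    Set (EuclideanSpace ℝ (Fin n) → ℝ) :=
  {u | u ∈ W1p Ω p ∧ ∀ δ : ℝ≥0∞, 0 < δ → ∃ φ : 𝓓(Ω, ℝ), W1pNorm Ω p (u - ⇑φ) < δ}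

/-- The cut-off `χ`: `1` for `p ∈ (1,2)` and `0` for `p ∈ (2,∞)`. -/
def chi (p : ℝ) : ℝ := if p < 2 then 1 else 0

/-- The stored energy density `H_{ε,p}(γ) = (|γ|² + χ(p) ε²)^{p/2} / p`. -/
def H (ε p : ℝ) (γ : EuclideanSpace ℝ (Fin n)) : ℝ :=
  (‖γ‖ ^ 2 + chi p * ε ^ 2) ^ (p / 2) / p

/-- The functional `I[u] = (1/p) ∫_Ω |∇u|^p dx - ∫_Ω f u dx`.
On `W^{1,p}(Ω)`, with `f` in the dual Lebesgue space, both integrands are integrable. -/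
def energy (Ω : TopologicalSpace.Opens (EuclideanSpace ℝ (Fin n))) (p : ℝ)
    (f u : EuclideanSpace ℝ (Fin n) → ℝ) : ℝ :=
  1 / p * (∫ x in Ω, ‖weakGrad Ω u x‖ ^ p) - ∫ x in Ω, f x * u x

/-- The regularized functional `I^{(ε)}[u] = ∫_Ω H_{ε,p}(∇u) dx - ∫_Ω f u dx`.
On `W^{1,p}(Ω)`, with `Ω` bounded and `f` in the dual Lebesgue space, both integrands are
integrable. -/
def regEnergy (Ω : TopologicalSpace.Opens (EuclideanSpace ℝ (Fin n))) (ε p : ℝ)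
    (f u : EuclideanSpace ℝ (Fin n) → ℝ) : ℝ :=
  (∫ x in Ω, H ε p (weakGrad Ω u x)) - ∫ x in Ω, f x * u x

/-- `u` is a minimizer of the functional `J` over `W₀^{1,p}(Ω)`. -/
def IsMinimizer (Ω : TopologicalSpace.Opens (EuclideanSpace ℝ (Fin n))) (p : ℝ)
    (J : (EuclideanSpace ℝ (Fin n) → ℝ) → ℝ) (u : EuclideanSpace ℝ (Fin n) → ℝ) : Prop :=
  u ∈ W01p Ω p ∧ IsMinOn J (W01p Ω p) u

end PLaplace

end

/-! The energies become powers of a norm. Since `chi p` squares to itself, the density of the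
regularized functional is the `p`-th power of the Euclidean norm of `(∇u, χε)` in `ℝⁿ × ℝ`. Hence
each functional, with `ε = 0` for the unregularized one, is `‖A z + κ‖ ^ p / p - ℓ z` on the closed
space of pairs `z = (u, ∇u)`, with `A` and `ℓ` linear and `κ` encoding `ε`.

Such functionals are minimized without weak compactness. The map `‖·‖ ^ p` is uniformly convex on a
finite-dimensional strictly convex space, by compactness of the sphere, and the resulting inequality
is linear in `p`-th powers, so it integrates to `L^p`. Together with Poincaré's inequality it forces
any two near-minimizers to be close (`powFunctional_near_min`). Existence, uniqueness and strong
convergence of minimizing families all follow. The regularized minimizers minimize `I`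
asymptotically, because `I[u_ε] ≤ I^{(ε)}[u_ε] ≤ I^{(ε)}[ū] → I[ū]`.

For the sign, let `σ = ±1` be the sign of `f` and compare a minimizer `u` with `σ √(u² + ψ²)`, whose
squared gradient is at most `|∇u|² + |∇ψ|²` by Cauchy–Schwarz. Taking `ψ = 0` shows that `u` has the
sign of `f`. Taking `ψ = sφ` and `ε = 0`, the gradient energy grows by at most `O(s ^ r)` with `r >
1`, while on `{u = 0}` the load gains `s ∫ σ f |φ|`. As `s → 0` this gain must vanish, so `{u = 0}`
is null. This replaces the strong maximum principle. -/

noncomputable section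

namespace PLaplace

/-- A quantitative form of uniform convexity of `‖·‖ ^ p`: the distance of two points is controlled
by an arbitrarily small multiple of their size plus a multiple of their midpoint convexity gap. -/
def PowUniformConvex (Y : Type*) [NormedAddCommGroup Y] [NormedSpace ℝ Y] (p : ℝ) : Prop :=
  ∀ η : ℝ, 0 < η → ∃ C : ℝ, 0 ≤ C ∧ ∀ x y : Y,
    ‖x - y‖ ^ p ≤ η * (‖x‖ ^ p + ‖y‖ ^ p) +
      C * ((‖x‖ ^ p + ‖y‖ ^ p) / 2 - ‖(1 / 2 : ℝ) • (x + y)‖ ^ p)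

/-! ### Uniform convexity of `‖·‖ ^ p` in finite dimension -/

section Pointwise

variable {Y : Type*} [NormedAddCommGroup Y] [NormedSpace ℝ Y] {p : ℝ}

lemma half_add_rpow_le (hp : 1 < p) {s t : ℝ} (hs : 0 ≤ s) (ht : 0 ≤ t) :
    ((s + t) / 2) ^ p ≤ (s ^ p + t ^ p) / 2 := by
  have := (convexOn_rpow hp.le).2 (Set.mem_Ici.2 hs) (Set.mem_Ici.2 ht)
    (by norm_num : (0 : ℝ) ≤ 1 / 2) (by norm_num : (0 : ℝ) ≤ 1 / 2) (by norm_num)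
  simp only [smul_eq_mul] at this
  calc ((s + t) / 2) ^ p = (1 / 2 * s + 1 / 2 * t) ^ p := by ring_nf
    _ ≤ _ := this
    _ = _ := by ring

lemma half_add_rpow_lt (hp : 1 < p) {s t : ℝ} (hs : 0 ≤ s) (ht : 0 ≤ t) (hst : s ≠ t) :
    ((s + t) / 2) ^ p < (s ^ p + t ^ p) / 2 := by
  have := (strictConvexOn_rpow hp).2 (Set.mem_Ici.2 hs) (Set.mem_Ici.2 ht) hst
    (by norm_num : (0 : ℝ) < 1 / 2) (by norm_num : (0 : ℝ) < 1 / 2) (by norm_num)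
  simp only [smul_eq_mul] at this
  calc ((s + t) / 2) ^ p = (1 / 2 * s + 1 / 2 * t) ^ p := by ring_nf
    _ < _ := this
    _ = _ := by ring

lemma norm_half_smul_add_le (x y : Y) : ‖(1 / 2 : ℝ) • (x + y)‖ ≤ (‖x‖ + ‖y‖) / 2 := by
  rw [norm_smul]
  have := norm_add_le x y
  norm_num
  linarith

lemma norm_midpoint_rpow_le (hp : 1 < p) (x y : Y) :
    ‖(1 / 2 : ℝ) • (x + y)‖ ^ p ≤ (‖x‖ ^ p + ‖y‖ ^ p) / 2 :=
  (Real.rpow_le_rpow (norm_nonneg _) (norm_half_smul_add_le x y) (by linarith)).trans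
    (half_add_rpow_le hp (norm_nonneg x) (norm_nonneg y))

/-- Points of equal norm are handled by strict convexity of the norm, points of different norms by
strict convexity of `t ↦ t ^ p`. -/
lemma norm_midpoint_rpow_lt [StrictConvexSpace ℝ Y] (hp : 1 < p) {x y : Y} (hxy : x ≠ y) :
    ‖(1 / 2 : ℝ) • (x + y)‖ ^ p < (‖x‖ ^ p + ‖y‖ ^ p) / 2 := by
  by_cases h : ‖x‖ = ‖y‖
  · have h1 : ‖(1 / 2 : ℝ) • x + (1 / 2 : ℝ) • y‖ < ‖y‖ :=
      norm_combo_lt_of_ne h.le le_rfl hxy (by norm_num) (by norm_num) (by norm_num)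
    rw [h, add_self_div_two, smul_add]
    exact Real.rpow_lt_rpow (norm_nonneg _) h1 (by linarith)
  · exact (Real.rpow_le_rpow (norm_nonneg _) (norm_half_smul_add_le x y) (by linarith)).trans_lt
      (half_add_rpow_lt hp (norm_nonneg x) (norm_nonneg y) h)

lemma norm_sub_rpow_le {Z : Type*} [NormedAddCommGroup Z] (hp : 1 < p) (x y : Z) :
    ‖x - y‖ ^ p ≤ 2 ^ p * (‖x‖ ^ p + ‖y‖ ^ p) := by
  have h2 := half_add_rpow_le hp (norm_nonneg x) (norm_nonneg y)
  rw [Real.div_rpow (by positivity) (by norm_num), div_le_iff₀ (by positivity)] at h2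
  have h1 : ‖x - y‖ ^ p ≤ (‖x‖ + ‖y‖) ^ p :=
    Real.rpow_le_rpow (norm_nonneg _) (norm_sub_le x y) (by linarith)
  have h3 : 0 ≤ (‖x‖ ^ p + ‖y‖ ^ p) * 2 ^ p := by positivity
  nlinarith

/-- Both sides are homogeneous of degree `p`, so the unit sphere of `Y × Y` suffices. There the
pairs not covered by the `η` term form a compact set avoiding the diagonal, on which the convexity
gap has a positive minimum. This treats all `p > 1` at once. -/
lemma powUniformConvex_of_finiteDimensional [StrictConvexSpace ℝ Y] [FiniteDimensional ℝ Y]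
    (hp : 1 < p) : PowUniformConvex Y p := by
  intro η hη
  have hp0 : 0 ≤ p := by linarith
  have := FiniteDimensional.proper ℝ Y
  let D : Y × Y → ℝ := fun z => (‖z.1‖ ^ p + ‖z.2‖ ^ p) / 2 - ‖(1 / 2 : ℝ) • (z.1 + z.2)‖ ^ p
  have hD : Continuous D := by
    have : ∀ t : Y × Y → ℝ, Continuous t → Continuous (fun z => t z ^ p) :=
      fun t ht => ht.rpow_const (fun _ => Or.inr hp0)
    exact (((this _ (by fun_prop)).add (this _ (by fun_prop))).div_const 2).sub
      (this _ (by fun_prop))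
  have hDnonneg : ∀ z, 0 ≤ D z := fun z => sub_nonneg.2 (norm_midpoint_rpow_le hp _ _)
  let K : Set (Y × Y) := Metric.sphere 0 1 ∩
    {z | η * (‖z.1‖ ^ p + ‖z.2‖ ^ p) ≤ ‖z.1 - z.2‖ ^ p}
  have hK : IsCompact K := by
    refine (isCompact_sphere _ _).inter_right (isClosed_le ?_ ?_)
    · exact continuous_const.mul ((continuous_fst.norm.rpow_const fun _ => Or.inr hp0).add
        (continuous_snd.norm.rpow_const fun _ => Or.inr hp0))
    · exact (continuous_fst.sub continuous_snd).norm.rpow_const fun _ => Or.inr hp0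
  have hDpos : ∀ z ∈ K, 0 < D z := by
    rintro ⟨x, y⟩ ⟨h1, h2⟩
    refine sub_pos.2 (norm_midpoint_rpow_lt hp fun hxy => ?_)
    obtain rfl : x = y := hxy
    simp only [Set.mem_ofPred_eq, sub_self, norm_zero, Real.zero_rpow (by linarith : p ≠ 0)] at h2
    have : 0 < ‖x‖ := by
      simp only [mem_sphere_iff_norm, sub_zero, Prod.norm_def, max_self] at h1
      linarith
    have : 0 < ‖x‖ ^ p := by positivity
    nlinarith
  obtain ⟨d, hd, hdK⟩ : ∃ d > 0, ∀ z ∈ K, d ≤ D z := by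
    rcases K.eq_empty_or_nonempty with h | h
    · exact ⟨1, one_pos, by simp [h]⟩
    · obtain ⟨z, hz, hz'⟩ := hK.exists_isMinOn h hD.continuousOn
      exact ⟨D z, hDpos z hz, fun w hw => hz' hw⟩
  -- On `K` the left side is at most `2 ^ p * 2`, since both components have norm at most `1`, and
  -- the gap is at least `d`; this gives the constant `2 ^ p * 2 / d`.
  have hsphere : ∀ z ∈ Metric.sphere (0 : Y × Y) 1,
      ‖z.1 - z.2‖ ^ p ≤ η * (‖z.1‖ ^ p + ‖z.2‖ ^ p) + (2 ^ p * 2 / d) * D z := by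
    intro z hz
    have hS : 0 ≤ ‖z.1‖ ^ p + ‖z.2‖ ^ p := by positivity
    by_cases h : η * (‖z.1‖ ^ p + ‖z.2‖ ^ p) ≤ ‖z.1 - z.2‖ ^ p
    · have h1 := hdK z ⟨hz, h⟩
      have hn : ‖z‖ = 1 := by simpa using hz
      have a1 : ‖z.1‖ ^ p ≤ 1 := Real.rpow_le_one (norm_nonneg _) (hn ▸ norm_fst_le z) hp0
      have a2 : ‖z.2‖ ^ p ≤ 1 := Real.rpow_le_one (norm_nonneg _) (hn ▸ norm_snd_le z) hp0
      have h3 := norm_sub_rpow_le hp z.1 z.2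
      have h4 : (2 : ℝ) ^ p * 2 ≤ 2 ^ p * 2 / d * D z := by
        rw [div_mul_eq_mul_div, le_div_iff₀ hd]
        exact mul_le_mul_of_nonneg_left h1 (by positivity)
      have h5 : (2 : ℝ) ^ p * (‖z.1‖ ^ p + ‖z.2‖ ^ p) ≤ 2 ^ p * 2 :=
        mul_le_mul_of_nonneg_left (by linarith) (by positivity)
      have : 0 ≤ η * (‖z.1‖ ^ p + ‖z.2‖ ^ p) := by positivity
      linarith
    · have : 0 ≤ (2 ^ p * 2 / d) * D z := mul_nonneg (by positivity) (hDnonneg z)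
      linarith
  refine ⟨2 ^ p * 2 / d, by positivity, fun x y => ?_⟩
  by_cases h0 : (x, y) = 0
  · obtain ⟨rfl, rfl⟩ := Prod.mk_eq_zero.1 h0
    simp [Real.zero_rpow (by linarith : p ≠ 0)]
  · have ht : 0 < ‖(x, y)‖ := norm_pos_iff.2 h0
    set t := ‖(x, y)‖ with ht_def
    have hz := hsphere (t⁻¹ • (x, y)) (by
      rw [mem_sphere_zero_iff_norm, norm_smul, norm_inv, ← ht_def, Real.norm_of_nonneg ht.le,
        inv_mul_cancel₀ ht.ne'])
    have hsc : ∀ w : Y, ‖t⁻¹ • w‖ ^ p = (t ^ p)⁻¹ * ‖w‖ ^ p := fun w => by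
      rw [norm_smul, Real.mul_rpow (norm_nonneg _) (norm_nonneg _), Real.norm_of_nonneg
        (by positivity), Real.inv_rpow ht.le]
    simp only [D, Prod.smul_mk, ← smul_sub, ← smul_add, smul_comm (1 / 2 : ℝ) t⁻¹, hsc] at hz
    have htp : 0 < t ^ p := by positivity
    have := mul_le_mul_of_nonneg_left hz htp.le
    have e := mul_inv_cancel₀ htp.ne'
    calc ‖x - y‖ ^ p = t ^ p * ((t ^ p)⁻¹ * ‖x - y‖ ^ p) := by rw [← mul_assoc, e, one_mul]
      _ ≤ _ := this
      _ = (t ^ p * (t ^ p)⁻¹) * (η * (‖x‖ ^ p + ‖y‖ ^ p) + 2 ^ p * 2 / d *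
        ((‖x‖ ^ p + ‖y‖ ^ p) / 2 - ‖(1 / 2 : ℝ) • (x + y)‖ ^ p)) := by ring
      _ = _ := by rw [e, one_mul]

end Pointwise

/-! ### Passage to `L^p` -/

section Lp

variable {α : Type*} [MeasurableSpace α] {μ : Measure α} {Y : Type*} [NormedAddCommGroup Y]
  {p : ℝ}

lemma MemLp.integrable_norm_rpow_ofReal (hp : 1 < p) {g : α → Y}
    (hg : MemLp g (ENNReal.ofReal p) μ) : Integrable (fun x => ‖g x‖ ^ p) μ := by
  have := hg.integrable_norm_rpow (by simpa using by linarith) ENNReal.ofReal_ne_top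
  simpa [ENNReal.toReal_ofReal (by linarith : (0 : ℝ) ≤ p)] using this

lemma Lp.norm_rpow_eq_integral (hp : 1 < p) (g : Lp Y (ENNReal.ofReal p) μ) :
    ‖g‖ ^ p = ∫ x, ‖g x‖ ^ p ∂μ := by
  have hp0 : 0 < p := by linarith
  rw [Lp.norm_def, (Lp.memLp g).eLpNorm_eq_integral_rpow_norm (by simpa using hp0)
    ENNReal.ofReal_ne_top, ENNReal.toReal_ofReal hp0.le, ENNReal.toReal_ofReal (by positivity),
    Real.rpow_inv_rpow (by positivity) hp0.ne']

/-- The constant does not depend on the points and the inequality is linear in `p`-th powers of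
norms, so it can be integrated as it stands. -/
lemma PowUniformConvex.lp [NormedSpace ℝ Y] [Fact (1 ≤ ENNReal.ofReal p)] (hp : 1 < p)
    (h : PowUniformConvex Y p) : PowUniformConvex (Lp Y (ENNReal.ofReal p) μ) p := by
  intro η hη
  obtain ⟨C, hC, hCxy⟩ := h η hη
  refine ⟨C, hC, fun x y => ?_⟩
  have hint := fun g : Lp Y (ENNReal.ofReal p) μ =>
    MemLp.integrable_norm_rpow_ofReal hp (Lp.memLp g)
  simp only [Lp.norm_rpow_eq_integral hp]
  rw [← integral_add (hint x) (hint y), ← integral_div, ← integral_sub _ (hint _),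
    ← integral_const_mul, ← integral_const_mul, ← integral_add]
  · refine integral_mono_ae (hint _) ?_ ?_
    · exact (((hint x).add (hint y)).const_mul η).add
        (((((hint x).add (hint y)).div_const 2).sub (hint _)).const_mul C)
    · filter_upwards [Lp.coeFn_sub x y, Lp.coeFn_smul (1 / 2 : ℝ) (x + y), Lp.coeFn_add x y]
        with a h1 h2 h3
      simp only [h1, h2, Pi.smul_apply, h3, Pi.sub_apply, Pi.add_apply]
      exact hCxy (x a) (y a)
  · exact ((hint x).add (hint y)).const_mul η
  · exact ((((hint x).add (hint y)).div_const 2).sub (hint _)).const_mul C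
  · exact ((hint x).add (hint y)).div_const 2

end Lp

/-! ### Minimization of `‖A z + κ‖ ^ p / p - ℓ z` -/

section Minimization

variable {V Y : Type*} [NormedAddCommGroup V] [NormedSpace ℝ V] [NormedAddCommGroup Y]
  [NormedSpace ℝ Y]

/-- The functional `z ↦ ‖A z + κ‖ ^ p / p - ℓ z`. -/
def powFunctional (p : ℝ) (A : V →L[ℝ] Y) (κ : Y) (ℓ : V →L[ℝ] ℝ) (z : V) : ℝ :=
  1 / p * ‖A z + κ‖ ^ p - ℓ z

variable {p : ℝ} {A : V →L[ℝ] Y} {C : ℝ}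

lemma powFunctional_continuous (hp : 1 < p) (κ : Y) (ℓ : V →L[ℝ] ℝ) :
    Continuous (powFunctional p A κ ℓ) :=
  (continuous_const.mul ((A.continuous.add continuous_const).norm.rpow_const
    fun _ => Or.inr (by linarith))).sub ℓ.continuous

lemma powFunctional_coercive (hp : 1 < p) (hC : 0 ≤ C) (hA : ∀ z, ‖z‖ ≤ C * ‖A z‖) (κ : Y)
    (ℓ : V →L[ℝ] ℝ) : ∃ K : ℝ, ∀ z, ‖A z + κ‖ ≤ powFunctional p A κ ℓ z + K := by
  set q := p.conjExponent
  have hpq : p.HolderConjugate q := Real.HolderConjugate.conjExponent hp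
  set c := ‖ℓ‖ * C
  have hc : 0 ≤ c := by positivity
  refine ⟨(c + 1) ^ q / q + c * ‖κ‖, fun z => ?_⟩
  -- Young is applied with `c + 1` instead of `c`: the load absorbs `c` copies of `‖A z + κ‖` and
  -- one copy remains.
  have h1 := Real.young_inequality_of_nonneg (norm_nonneg (A z + κ)) (by linarith : 0 ≤ c + 1) hpq
  have h2 : ℓ z ≤ c * (‖A z + κ‖ + ‖κ‖) := by
    calc ℓ z ≤ ‖ℓ‖ * ‖z‖ := (le_abs_self _).trans (ℓ.le_opNorm z)
      _ ≤ ‖ℓ‖ * (C * ‖A z‖) := by gcongr; exact hA z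
      _ = c * ‖A z‖ := by simp only [c]; ring
      _ ≤ _ := by
        gcongr
        simpa using norm_sub_le (A z + κ) κ
  unfold powFunctional
  have h3 : 1 / p * ‖A z + κ‖ ^ p = ‖A z + κ‖ ^ p / p := by ring
  rw [h3]
  nlinarith

/-- The value at the midpoint is at least `m` and `ℓ` cancels from the midpoint inequality, so the
convexity gap of `A x + κ` and `A y + κ` is at most `p * δ`. Uniform convexity then bounds `A (x -
y)`, and `hA` bounds `x - y`. -/
lemma powFunctional_near_min (hp : 1 < p) (hY : PowUniformConvex Y p) (hC : 0 ≤ C)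
    (hA : ∀ z, ‖z‖ ≤ C * ‖A z‖) (κ : Y) (ℓ : V →L[ℝ] ℝ) {m : ℝ}
    (hm : ∀ z, m ≤ powFunctional p A κ ℓ z) {ε : ℝ} (hε : 0 < ε) :
    ∃ δ > 0, ∀ x y, powFunctional p A κ ℓ x ≤ m + δ → powFunctional p A κ ℓ y ≤ m + δ →
      ‖x - y‖ ≤ ε := by
  have hp0 : 0 < p := by linarith
  obtain ⟨K, hK⟩ := powFunctional_coercive hp hC hA κ ℓ
  set R := max (m + 1 + K) 1
  have hR : 0 < R := lt_of_lt_of_le one_pos (le_max_right _ _)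
  set e := ε / (C + 1)
  have he : 0 < e := by positivity
  -- `R` bounds `‖A z + κ‖` on the sublevel set. This `η` makes the first term of uniform convexity
  -- at most `e ^ p / 2`; the choice of `δ` below does the same for the gap term.
  obtain ⟨B, hB, hBxy⟩ := hY (e ^ p / (4 * R ^ p)) (by positivity)
  refine ⟨min 1 (e ^ p / (2 * p * (B + 1))), by positivity, fun x y hx hy => ?_⟩
  set δ := min 1 (e ^ p / (2 * p * (B + 1)))
  have hδ1 : δ ≤ 1 := min_le_left _ _
  have hδ2 : δ ≤ e ^ p / (2 * p * (B + 1)) := min_le_right _ _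
  have hbd : ∀ z, powFunctional p A κ ℓ z ≤ m + δ → ‖A z + κ‖ ^ p ≤ R ^ p := fun z hz =>
    Real.rpow_le_rpow (norm_nonneg _)
      (((hK z).trans (by linarith)).trans (le_max_left (m + 1 + K) 1)) hp0.le
  have key := hBxy (A x + κ) (A y + κ)
  have hmid := hm ((1 / 2 : ℝ) • (x + y))
  have e1 : A ((1 / 2 : ℝ) • (x + y)) + κ = (1 / 2 : ℝ) • ((A x + κ) + (A y + κ)) := by
    rw [map_smul, map_add]
    module
  have e2 : (A x + κ) - (A y + κ) = A (x - y) := by rw [map_sub]; abel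
  rw [e2] at key
  unfold powFunctional at hmid hx hy
  rw [e1, map_smul, map_add, smul_eq_mul] at hmid
  set G := (‖A x + κ‖ ^ p + ‖A y + κ‖ ^ p) / 2 - ‖(1 / 2 : ℝ) • ((A x + κ) + (A y + κ))‖ ^ p
    with hG
  have hGδ : G ≤ p * δ := by
    have : 1 / p * G ≤ δ := by rw [hG]; linarith
    rw [one_div_mul_eq_div, div_le_iff₀ hp0] at this
    linarith
  have hBG : B * G ≤ e ^ p / 2 := by
    calc B * G ≤ B * (p * δ) := by gcongr
      _ ≤ (B + 1) * (p * (e ^ p / (2 * p * (B + 1)))) := by gcongr; linarith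
      _ = e ^ p / 2 := by field_simp
  have hsmall : e ^ p / (4 * R ^ p) * (‖A x + κ‖ ^ p + ‖A y + κ‖ ^ p) ≤ e ^ p / 2 := by
    calc _ ≤ e ^ p / (4 * R ^ p) * (R ^ p + R ^ p) := by
          have := hbd x hx
          have := hbd y hy
          exact mul_le_mul_of_nonneg_left (by linarith) (by positivity)
      _ = e ^ p / 2 := by
          have : R ^ p ≠ 0 := by positivity
          field_simp
          ring
  have hfin : ‖A (x - y)‖ ≤ e :=
    (Real.rpow_le_rpow_iff (norm_nonneg _) he.le hp0).1 (by linarith)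
  calc ‖x - y‖ ≤ C * ‖A (x - y)‖ := hA _
    _ ≤ (C + 1) * e := by gcongr; linarith
    _ = ε := by simp only [e]; field_simp

lemma powFunctional_tendsto_of_minimizing (hp : 1 < p) (hY : PowUniformConvex Y p) (hC : 0 ≤ C)
    (hA : ∀ z, ‖z‖ ≤ C * ‖A z‖) (κ : Y) (ℓ : V →L[ℝ] ℝ) {z : V}
    (hz : ∀ w, powFunctional p A κ ℓ z ≤ powFunctional p A κ ℓ w) {ι : Type*} {F : Filter ι}
    {w : ι → V} (hw : Tendsto (fun i => powFunctional p A κ ℓ (w i)) F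
      (𝓝 (powFunctional p A κ ℓ z))) : Tendsto w F (𝓝 z) := by
  rw [Metric.tendsto_nhds]
  intro ε hε
  obtain ⟨δ, hδ, h⟩ := powFunctional_near_min hp hY hC hA κ ℓ hz (half_pos hε)
  filter_upwards [hw.eventually (gt_mem_nhds (by linarith : powFunctional p A κ ℓ z <
    powFunctional p A κ ℓ z + δ))] with i hi
  rw [dist_eq_norm]
  exact (h _ _ hi.le (by linarith)).trans_lt (by linarith)

lemma powFunctional_minimizer_unique (hp : 1 < p) (hY : PowUniformConvex Y p) (hC : 0 ≤ C)
    (hA : ∀ z, ‖z‖ ≤ C * ‖A z‖) (κ : Y) (ℓ : V →L[ℝ] ℝ) {z z' : V}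
    (hz : ∀ w, powFunctional p A κ ℓ z ≤ powFunctional p A κ ℓ w)
    (hz' : ∀ w, powFunctional p A κ ℓ z' ≤ powFunctional p A κ ℓ w) : z' = z := by
  -- A second minimizer is a constant minimizing family, so it converges to the first.
  have h := powFunctional_tendsto_of_minimizing hp hY hC hA κ ℓ hz (F := (pure () : Filter Unit))
    (w := fun _ => z') (by rw [le_antisymm (hz' z) (hz z')]; exact tendsto_const_nhds)
  exact tendsto_nhds_unique tendsto_const_nhds h

/-- Minimizing sequences are Cauchy by `powFunctional_near_min`, so completeness and continuity give
the minimizer. -/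
lemma exists_powFunctional_minimizer [CompleteSpace V] (hp : 1 < p) (hY : PowUniformConvex Y p)
    (hC : 0 ≤ C) (hA : ∀ z, ‖z‖ ≤ C * ‖A z‖) (κ : Y) (ℓ : V →L[ℝ] ℝ) :
    ∃ z, ∀ w, powFunctional p A κ ℓ z ≤ powFunctional p A κ ℓ w := by
  set J := powFunctional p A κ ℓ
  obtain ⟨K, hK⟩ := powFunctional_coercive hp hC hA κ ℓ
  have hbdd : BddBelow (Set.range J) :=
    ⟨-K, by rintro _ ⟨z, rfl⟩; linarith [hK z, norm_nonneg (A z + κ)]⟩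
  set m := ⨅ z, J z
  have hm : ∀ z, m ≤ J z := ciInf_le hbdd
  have hex : ∀ k : ℕ, ∃ z, J z < m + 1 / ((k : ℝ) + 1) := fun k =>
    exists_lt_of_ciInf_lt (by linarith [Nat.one_div_pos_of_nat (α := ℝ) (n := k)])
  choose w hw using hex
  have hcauchy : CauchySeq w := by
    refine Metric.cauchySeq_iff.2 fun ε hε => ?_
    obtain ⟨δ, hδ, h⟩ := powFunctional_near_min hp hY hC hA κ ℓ hm (half_pos hε)
    obtain ⟨N, hN⟩ := exists_nat_one_div_lt hδ
    have hle : ∀ k ≥ N, J (w k) ≤ m + δ := fun k hk => by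
      have : 1 / ((k : ℝ) + 1) ≤ 1 / ((N : ℝ) + 1) := Nat.one_div_le_one_div hk
      linarith [hw k]
    refine ⟨N, fun i hi j hj => ?_⟩
    rw [dist_eq_norm]
    exact (h _ _ (hle i hi) (hle j hj)).trans_lt (by linarith)
  obtain ⟨z, hz⟩ := cauchySeq_tendsto_of_complete hcauchy
  have h1 : Tendsto (fun k => J (w k)) atTop (𝓝 (J z)) :=
    ((powFunctional_continuous hp κ ℓ).tendsto z).comp hz
  have h2 : Tendsto (fun k : ℕ => m + 1 / ((k : ℝ) + 1)) atTop (𝓝 (m + 0)) :=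
    tendsto_const_nhds.add tendsto_one_div_add_atTop_nhds_zero_nat
  have h3 : J z ≤ m := by simpa using le_of_tendsto_of_tendsto' h1 h2 fun k => (hw k).le
  exact ⟨z, fun y => h3.trans (hm y)⟩

end Minimization

variable {n : ℕ} {Ω : TopologicalSpace.Opens (EuclideanSpace ℝ (Fin n))} {p q : ℝ}

/-! ### Weak gradients -/

section WeakGradient

lemma LocallyIntegrableOn.integrable_smul_of_tsupport_subset {Y : Type*} [NormedAddCommGroup Y]
    [NormedSpace ℝ Y] {u : EuclideanSpace ℝ (Fin n) → Y}
    (hu : LocallyIntegrableOn u (Ω : Set (EuclideanSpace ℝ (Fin n))) volume)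
    {g : EuclideanSpace ℝ (Fin n) → ℝ} (hg : Continuous g) (hgc : HasCompactSupport g)
    (hgs : tsupport g ⊆ Ω) : Integrable (fun x => g x • u x) := by
  have h1 : IntegrableOn u (tsupport g) := hu.integrableOn_compact_subset hgs hgc
  have h2 : IntegrableOn (fun x => g x • u x) (tsupport g) :=
    h1.continuousOn_smul hg.continuousOn hgc
  refine (integrableOn_iff_integrable_of_support_subset ?_).1 h2
  intro x hx
  by_contra h
  exact hx (by simp [image_eq_zero_of_notMem_tsupport h])

lemma HasWeakGradient.ae_unique {u : EuclideanSpace ℝ (Fin n) → ℝ}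
    {G G' : EuclideanSpace ℝ (Fin n) → EuclideanSpace ℝ (Fin n)} (h : HasWeakGradient Ω u G)
    (h' : HasWeakGradient Ω u G') : G =ᵐ[volume.restrict Ω] G' := by
  have key : ∀ᵐ x ∂volume, x ∈ (Ω : Set (EuclideanSpace ℝ (Fin n))) → (G - G') x = 0 := by
    refine Ω.isOpen.ae_eq_zero_of_integral_contDiff_smul_eq_zero (h.2.1.sub h'.2.1) ?_
    intro g hg hgc hgs
    have i1 := LocallyIntegrableOn.integrable_smul_of_tsupport_subset h.2.1 hg.continuous hgc hgs
    have i2 := LocallyIntegrableOn.integrable_smul_of_tsupport_subset h'.2.1 hg.continuous hgc hgs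
    have hset : ∀ H : EuclideanSpace ℝ (Fin n) → EuclideanSpace ℝ (Fin n),
        ∫ x in Ω, g x • H x = ∫ x, g x • H x := fun H =>
      setIntegral_eq_integral_of_forall_compl_eq_zero fun x hx => by
        rw [image_eq_zero_of_notMem_tsupport fun hx' => hx (hgs hx'), zero_smul]
    simp only [Pi.sub_apply, smul_sub]
    rw [integral_sub i1 i2, sub_eq_zero]
    -- The definition tests one direction at a time, so the vector integrals are compared through
    -- their inner products with `v`.
    refine ext_inner_left ℝ fun v => ?_
    have e1 := h.2.2 ⟨g, hg, hgc, hgs⟩ v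
    have e2 := h'.2.2 ⟨g, hg, hgc, hgs⟩ v
    have e3 : ∀ H : EuclideanSpace ℝ (Fin n) → EuclideanSpace ℝ (Fin n),
        Integrable (fun x => g x • H x) →
        inner ℝ v (∫ x, g x • H x) = ∫ x in Ω, g x * inner ℝ (H x) v := fun H hH => by
      rw [← hset, ← integral_inner hH.integrableOn]
      refine integral_congr_ae (Eventually.of_forall fun x => ?_)
      simp [real_inner_smul_right, real_inner_comm]
    rw [e3 G i1, e3 G' i2]
    exact neg_injective (e1.symm.trans e2)
  rw [EventuallyEq, ae_restrict_iff' Ω.isOpen.measurableSet]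
  filter_upwards [key] with x hx hxΩ
  exact sub_eq_zero.1 (hx hxΩ)

lemma hasWeakGradient_weakGrad {u : EuclideanSpace ℝ (Fin n) → ℝ}
    (h : ∃ G, HasWeakGradient Ω u G) : HasWeakGradient Ω u (weakGrad Ω u) := by
  rw [weakGrad, dif_pos h]
  exact h.choose_spec

lemma HasWeakGradient.weakGrad_ae_eq {u : EuclideanSpace ℝ (Fin n) → ℝ}
    {G : EuclideanSpace ℝ (Fin n) → EuclideanSpace ℝ (Fin n)} (h : HasWeakGradient Ω u G) :
    weakGrad Ω u =ᵐ[volume.restrict Ω] G :=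
  (hasWeakGradient_weakGrad ⟨G, h⟩).ae_unique h

lemma tsupport_fderiv_apply_subset (φ : EuclideanSpace ℝ (Fin n) → ℝ)
    (v : EuclideanSpace ℝ (Fin n)) : tsupport (fun x => fderiv ℝ φ x v) ⊆ tsupport φ :=
  (closure_mono (Function.support_subset_iff'.2 fun x hx => by
    simp [Function.notMem_support.1 hx])).trans (tsupport_fderiv_subset ℝ (f := φ))

lemma TestFunction.continuous_fderiv_apply (φ : 𝓓(Ω, ℝ)) (v : EuclideanSpace ℝ (Fin n)) :
    Continuous fun x => fderiv ℝ φ x v :=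
  (φ.contDiff.continuous_fderiv (by simp)).clm_apply continuous_const

lemma TestFunction.hasCompactSupport_fderiv_apply (φ : 𝓓(Ω, ℝ)) (v : EuclideanSpace ℝ (Fin n)) :
    HasCompactSupport fun x => fderiv ℝ φ x v :=
  φ.hasCompactSupport.of_isClosed_subset (isClosed_tsupport _) (tsupport_fderiv_apply_subset φ v)

lemma HasWeakGradient.sub {u u' : EuclideanSpace ℝ (Fin n) → ℝ}
    {G G' : EuclideanSpace ℝ (Fin n) → EuclideanSpace ℝ (Fin n)} (h : HasWeakGradient Ω u G)
    (h' : HasWeakGradient Ω u' G') : HasWeakGradient Ω (u - u') (G - G') := by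
  refine ⟨h.1.sub h'.1, h.2.1.sub h'.2.1, fun φ v => ?_⟩
  have a : ∀ w : EuclideanSpace ℝ (Fin n) → ℝ, LocallyIntegrableOn w Ω volume →
      IntegrableOn (fun x => w x * fderiv ℝ φ x v) Ω := fun w hw => by
    have := LocallyIntegrableOn.integrable_smul_of_tsupport_subset hw
      (TestFunction.continuous_fderiv_apply φ v) (TestFunction.hasCompactSupport_fderiv_apply φ v)
      ((tsupport_fderiv_apply_subset φ v).trans φ.tsupport_subset)
    simpa only [smul_eq_mul, mul_comm] using this.integrableOn
  have b : ∀ H : EuclideanSpace ℝ (Fin n) → EuclideanSpace ℝ (Fin n),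
      LocallyIntegrableOn H Ω volume →
      IntegrableOn (fun x => φ x * inner ℝ (H x) v) Ω := fun H hH => by
    have := (LocallyIntegrableOn.integrable_smul_of_tsupport_subset hH φ.continuous
      φ.hasCompactSupport φ.tsupport_subset).inner_const (𝕜 := ℝ) v
    simpa only [real_inner_smul_left] using this.integrableOn
  simp only [Pi.sub_apply, sub_mul, inner_sub_left, mul_sub]
  rw [integral_sub (a _ h.1) (a _ h'.1), integral_sub (b _ h.2.1) (b _ h'.2.1), h.2.2, h'.2.2]
  ring

lemma HasWeakGradient.congr {u u' : EuclideanSpace ℝ (Fin n) → ℝ}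
    {G G' : EuclideanSpace ℝ (Fin n) → EuclideanSpace ℝ (Fin n)} (h : HasWeakGradient Ω u G)
    (hu : u =ᵐ[volume.restrict Ω] u') (hG : G =ᵐ[volume.restrict Ω] G')
    (hu' : LocallyIntegrableOn u' Ω) (hG' : LocallyIntegrableOn G' Ω) :
    HasWeakGradient Ω u' G' := by
  refine ⟨hu', hG', fun φ v => ?_⟩
  have e1 : ∫ x in Ω, u' x * fderiv ℝ φ x v = ∫ x in Ω, u x * fderiv ℝ φ x v :=
    integral_congr_ae (by filter_upwards [hu] with x hx; rw [hx])
  have e2 : ∫ x in Ω, φ x * inner ℝ (G' x) v = ∫ x in Ω, φ x * inner ℝ (G x) v :=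
    integral_congr_ae (by filter_upwards [hG] with x hx; rw [hx])
  rw [e1, e2]
  exact h.2.2 φ v

end WeakGradient

/-! ### Test functions and their classical gradients -/

section TestFunctions

lemma TestFunction.differentiableAt (φ : 𝓓(Ω, ℝ)) (x : EuclideanSpace ℝ (Fin n)) :
    DifferentiableAt ℝ φ x :=
  (φ.contDiff.differentiable (by simp)) x

lemma TestFunction.continuous_gradient (φ : 𝓓(Ω, ℝ)) : Continuous (gradient φ) :=
  (InnerProductSpace.toDual ℝ _).symm.continuous.comp (φ.contDiff.continuous_fderiv (by simp))

lemma TestFunction.tsupport_gradient_subset (φ : 𝓓(Ω, ℝ)) : tsupport (gradient φ) ⊆ tsupport φ :=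
  (closure_mono (Function.support_subset_iff'.2 fun x hx => by
    simp [gradient, Function.notMem_support.1 hx])).trans (tsupport_fderiv_subset ℝ (f := φ))

lemma TestFunction.hasCompactSupport_gradient (φ : 𝓓(Ω, ℝ)) : HasCompactSupport (gradient φ) :=
  φ.hasCompactSupport.of_isClosed_subset (isClosed_tsupport _) (tsupport_gradient_subset φ)

lemma TestFunction.inner_gradient (φ : 𝓓(Ω, ℝ)) (x v : EuclideanSpace ℝ (Fin n)) :
    inner ℝ (gradient φ x) v = fderiv ℝ φ x v := by
  simp [gradient]

lemma TestFunction.memLp (φ : 𝓓(Ω, ℝ)) (r : ℝ≥0∞) : MemLp φ r (volume.restrict Ω) :=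
  φ.continuous.memLp_of_hasCompactSupport φ.hasCompactSupport

lemma TestFunction.memLp_gradient (φ : 𝓓(Ω, ℝ)) (r : ℝ≥0∞) :
    MemLp (gradient φ) r (volume.restrict Ω) :=
  (continuous_gradient φ).memLp_of_hasCompactSupport (hasCompactSupport_gradient φ)

lemma TestFunction.hasWeakGradient (φ : 𝓓(Ω, ℝ)) : HasWeakGradient Ω φ (gradient φ) := by
  refine ⟨φ.continuous.locallyIntegrable.locallyIntegrableOn _,
    (continuous_gradient φ).locallyIntegrable.locallyIntegrableOn _, fun ψ v => ?_⟩
  have hs : ∀ g : EuclideanSpace ℝ (Fin n) → ℝ, (∀ x, x ∉ tsupport φ → g x = 0) →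
      ∫ x in Ω, g x = ∫ x, g x := fun g hg =>
    setIntegral_eq_integral_of_forall_compl_eq_zero fun x hx =>
      hg x fun hx' => hx (φ.tsupport_subset hx')
  have hd : ∀ x, x ∉ tsupport φ → fderiv ℝ φ x v = 0 := fun x hx =>
    image_eq_zero_of_notMem_tsupport (f := fun x => fderiv ℝ φ x v) fun h =>
      hx (tsupport_fderiv_apply_subset φ v h)
  simp only [inner_gradient]
  rw [hs _ fun x hx => by simp [image_eq_zero_of_notMem_tsupport hx],
    hs _ fun x hx => by simp [hd x hx]]
  have hc : ∀ g : EuclideanSpace ℝ (Fin n) → ℝ, Continuous g → Integrable fun x => φ x * g x :=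
    fun g hg => (φ.continuous.mul hg).integrable_of_hasCompactSupport φ.hasCompactSupport.mul_right
  rw [integral_mul_fderiv_eq_neg_fderiv_mul_of_integrable]
  · simp only [mul_comm]
  · exact ((continuous_fderiv_apply φ v).mul ψ.continuous).integrable_of_hasCompactSupport
      (hasCompactSupport_fderiv_apply φ v).mul_right
  · exact hc _ (continuous_fderiv_apply ψ v)
  · exact hc _ ψ.continuous
  · exact fun x _ => differentiableAt φ x
  · exact fun x _ => differentiableAt ψ x

lemma TestFunction.gradient_add (φ ψ : 𝓓(Ω, ℝ)) :
    gradient (φ + ψ : 𝓓(Ω, ℝ)) = gradient φ + gradient ψ := by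
  ext1 x
  have : fderiv ℝ (φ + ψ : 𝓓(Ω, ℝ)) x = fderiv ℝ φ x + fderiv ℝ ψ x :=
    fderiv_add (differentiableAt φ x) (differentiableAt ψ x)
  simp only [gradient, this, map_add, Pi.add_apply]

lemma TestFunction.gradient_smul (c : ℝ) (φ : 𝓓(Ω, ℝ)) :
    gradient (c • φ : 𝓓(Ω, ℝ)) = c • gradient φ := by
  ext1 x
  have : fderiv ℝ (c • φ : 𝓓(Ω, ℝ)) x = c • fderiv ℝ φ x :=
    fderiv_const_smul (differentiableAt φ x) c
  simp only [gradient, this, map_smul, Pi.smul_apply]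

end TestFunctions

/-! ### `W₀^{1,p}` as a closed space of pairs `(u, ∇u)` -/

section Pairs

/-- Pairs consisting of a function in `L^p(Ω)` and a vector field in `L^p(Ω)`. -/
abbrev LpPair (Ω : TopologicalSpace.Opens (EuclideanSpace ℝ (Fin n))) (p : ℝ) : Type :=
  Lp ℝ (ENNReal.ofReal p) (volume.restrict (Ω : Set (EuclideanSpace ℝ (Fin n)))) ×
    Lp (EuclideanSpace ℝ (Fin n)) (ENNReal.ofReal p)
      (volume.restrict (Ω : Set (EuclideanSpace ℝ (Fin n))))

/-- The pair `(φ, ∇φ)` of a test function. -/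
def testPair (Ω : TopologicalSpace.Opens (EuclideanSpace ℝ (Fin n))) (p : ℝ) :
    𝓓(Ω, ℝ) →ₗ[ℝ] LpPair Ω p where
  toFun φ := ((TestFunction.memLp φ _).toLp, (TestFunction.memLp_gradient φ _).toLp)
  map_add' φ ψ := by
    refine Prod.ext rfl ?_
    simp only [TestFunction.gradient_add]
    rfl
  map_smul' c φ := by
    refine Prod.ext rfl ?_
    simp only [TestFunction.gradient_smul]
    rfl

lemma testPair_fst_ae (φ : 𝓓(Ω, ℝ)) : (testPair Ω p φ).1 =ᵐ[volume.restrict Ω] φ :=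
  (TestFunction.memLp φ _).coeFn_toLp

lemma testPair_snd_ae (φ : 𝓓(Ω, ℝ)) : (testPair Ω p φ).2 =ᵐ[volume.restrict Ω] gradient φ :=
  (TestFunction.memLp_gradient φ _).coeFn_toLp

lemma W1pNorm_sub_eq {u v : EuclideanSpace ℝ (Fin n) → ℝ} {z w : LpPair Ω p}
    {G H : EuclideanSpace ℝ (Fin n) → EuclideanSpace ℝ (Fin n)}
    (hu : HasWeakGradient Ω u G) (hv : HasWeakGradient Ω v H)
    (h1 : z.1 =ᵐ[volume.restrict Ω] u) (h2 : z.2 =ᵐ[volume.restrict Ω] G)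
    (h3 : w.1 =ᵐ[volume.restrict Ω] v) (h4 : w.2 =ᵐ[volume.restrict Ω] H) :
    W1pNorm Ω p (u - v) = edist z.1 w.1 + edist z.2 w.2 := by
  rw [W1pNorm, Lp.edist_def, Lp.edist_def]
  congr 1
  · exact eLpNorm_congr_ae (h1.sub h3).symm
  · exact eLpNorm_congr_ae ((hu.sub hv).weakGrad_ae_eq.trans (h2.sub h4).symm)

/-- The pair `(u, ∇u)` of an element of `W^{1,p}(Ω)`. -/
def pairOf {u : EuclideanSpace ℝ (Fin n) → ℝ} (hu : u ∈ W1p Ω p) : LpPair Ω p :=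
  (hu.1.toLp, hu.2.2.toLp)

variable [Fact (1 ≤ ENNReal.ofReal p)]

/-- The closed space of pairs `(u, ∇u)` with `u ∈ W₀^{1,p}(Ω)`. -/
def sobolevPairs (Ω : TopologicalSpace.Opens (EuclideanSpace ℝ (Fin n))) (p : ℝ)
    [Fact (1 ≤ ENNReal.ofReal p)] : Submodule ℝ (LpPair Ω p) :=
  (LinearMap.range (testPair Ω p)).topologicalClosure

instance : CompleteSpace (sobolevPairs Ω p) :=
  Submodule.topologicalClosure.completeSpace _

lemma testPair_mem (φ : 𝓓(Ω, ℝ)) : testPair Ω p φ ∈ sobolevPairs Ω p :=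
  Submodule.le_topologicalClosure _ ⟨φ, rfl⟩

/-- The density principle: closed conditions need checking only on test functions. -/
lemma sobolevPairs_induction {S : Set (LpPair Ω p)} (hS : IsClosed S)
    (h : ∀ φ, testPair Ω p φ ∈ S) {z : LpPair Ω p} (hz : z ∈ sobolevPairs Ω p) : z ∈ S := by
  have : closure (LinearMap.range (testPair Ω p) : Set (LpPair Ω p)) ⊆ S :=
    closure_minimal (by rintro _ ⟨φ, rfl⟩; exact h φ) hS
  exact this hz

lemma exists_testPair_tendsto {z : LpPair Ω p} (hz : z ∈ sobolevPairs Ω p) :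
    ∃ φ : ℕ → 𝓓(Ω, ℝ), Tendsto (fun k => testPair Ω p (φ k)) atTop (𝓝 z) := by
  obtain ⟨x, hx, hxz⟩ := mem_closure_iff_seq_limit.1
    (show z ∈ closure (LinearMap.range (testPair Ω p) : Set (LpPair Ω p)) from hz)
  choose φ hφ using hx
  exact ⟨φ, by simpa only [hφ] using hxz⟩

/-- Integration against a fixed `L^q` function, as a continuous functional on `L^p`. -/
def integralPairing {α : Type*} [MeasurableSpace α] {μ : Measure α} {Y : Type*}
    [NormedAddCommGroup Y] [InnerProductSpace ℝ Y] (hpq : p.HolderConjugate q) {g : α → Y}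
    (hg : MemLp g (ENNReal.ofReal q) μ) : Lp Y (ENNReal.ofReal p) μ →L[ℝ] ℝ :=
  haveI : Fact (1 ≤ ENNReal.ofReal q) := ⟨by simpa using hpq.symm.lt.le⟩
  haveI := hpq.ennrealOfReal
  let B : Y →L[ℝ] Y →L[ℝ] ℝ := innerSL ℝ
  (B.lpPairing μ (ENNReal.ofReal p) (ENNReal.ofReal q)).flip hg.toLp

lemma integralPairing_apply {α : Type*} [MeasurableSpace α] {μ : Measure α} {Y : Type*}
    [NormedAddCommGroup Y] [InnerProductSpace ℝ Y] (hpq : p.HolderConjugate q) {g : α → Y}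
    (hg : MemLp g (ENNReal.ofReal q) μ) (w : Lp Y (ENNReal.ofReal p) μ) :
    integralPairing hpq hg w = ∫ x, inner ℝ (w x) (g x) ∂μ := by
  have : Fact (1 ≤ ENNReal.ofReal q) := ⟨by simpa using hpq.symm.lt.le⟩
  have := hpq.ennrealOfReal
  rw [integralPairing]
  simp only [ContinuousLinearMap.flip_apply]
  rw [ContinuousLinearMap.lpPairing_eq_integral]
  refine integral_congr_ae ?_
  filter_upwards [hg.coeFn_toLp] with x hx
  rw [hx]
  rfl

lemma locallyIntegrableOn_of_memLp {Y : Type*} [NormedAddCommGroup Y]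
    {g : EuclideanSpace ℝ (Fin n) → Y}
    (hg : MemLp g (ENNReal.ofReal p) (volume.restrict Ω)) : LocallyIntegrableOn g Ω volume := by
  have h := hg.locallyIntegrable Fact.out
  intro x hx
  obtain ⟨s, hs, hsi⟩ := h x
  refine ⟨s ∩ Ω, inter_mem (mem_nhdsWithin_of_mem_nhds hs) self_mem_nhdsWithin, ?_⟩
  rw [IntegrableOn, ← Measure.restrict_restrict' Ω.isOpen.measurableSet]
  exact hsi

/-- For a fixed test function and direction, both sides of the integration by parts formula are
continuous on `L^p`, so the formula survives the closure. -/
lemma hasWeakGradient_of_mem (hpq : p.HolderConjugate q) {z : LpPair Ω p}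
    (hz : z ∈ sobolevPairs Ω p) : HasWeakGradient Ω z.1 z.2 := by
  refine ⟨locallyIntegrableOn_of_memLp (Lp.memLp _), locallyIntegrableOn_of_memLp (Lp.memLp _),
    fun φ v => ?_⟩
  have h1 : MemLp (fun x => fderiv ℝ φ x v) (ENNReal.ofReal q) (volume.restrict Ω) :=
    (TestFunction.continuous_fderiv_apply φ v).memLp_of_hasCompactSupport
      (TestFunction.hasCompactSupport_fderiv_apply φ v)
  have h2 : MemLp (fun x => φ x • v) (ENNReal.ofReal q) (volume.restrict Ω) :=
    (φ.continuous.smul continuous_const).memLp_of_hasCompactSupport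
      φ.hasCompactSupport.smul_right
  have e1 : ∀ w : Lp ℝ (ENNReal.ofReal p) (volume.restrict (Ω : Set _)),
      ∫ x in Ω, w x * fderiv ℝ φ x v = integralPairing hpq h1 w := fun w => by
    rw [integralPairing_apply]
    simp [mul_comm]
  have e2 : ∀ w : Lp (EuclideanSpace ℝ (Fin n)) (ENNReal.ofReal p) (volume.restrict (Ω : Set _)),
      ∫ x in Ω, φ x * inner ℝ (w x) v = integralPairing hpq h2 w := fun w => by
    rw [integralPairing_apply]
    simp [real_inner_smul_right]
  rw [e1, e2]
  refine sobolevPairs_induction (S := {z | integralPairing hpq h1 z.1 = -integralPairing hpq h2 z.2})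
    (isClosed_eq (by fun_prop) (by fun_prop)) (fun ψ => ?_) hz
  rw [Set.mem_ofPred_eq, ← e1, ← e2]
  have := (TestFunction.hasWeakGradient ψ).2.2 φ v
  rw [integral_congr_ae (g := fun x => ψ x * fderiv ℝ φ x v)
      (by filter_upwards [testPair_fst_ae (p := p) ψ] with x hx; rw [hx]), this, neg_inj]
  exact integral_congr_ae (by filter_upwards [testPair_snd_ae (p := p) ψ] with x hx; rw [hx])

lemma mem_W1p_of_mem (hpq : p.HolderConjugate q) {z : LpPair Ω p} (hz : z ∈ sobolevPairs Ω p) :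
    ⇑z.1 ∈ W1p Ω p :=
  ⟨Lp.memLp _, ⟨_, hasWeakGradient_of_mem hpq hz⟩,
    (memLp_congr_ae (hasWeakGradient_of_mem hpq hz).weakGrad_ae_eq).2 (Lp.memLp _)⟩

/-- With `mem_W01p_of_mem` this identifies `W₀^{1,p}` with the closed space of pairs: the sum norm
of the first and the max norm of the second define the same closure. -/
lemma pairOf_mem {u : EuclideanSpace ℝ (Fin n) → ℝ} (hu : u ∈ W01p Ω p) :
    pairOf hu.1 ∈ sobolevPairs Ω p := by
  refine EMetric.mem_closure_iff.2 fun δ hδ => ?_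
  obtain ⟨φ, hφ⟩ := hu.2 δ hδ
  refine ⟨testPair Ω p φ, ⟨φ, rfl⟩, lt_of_le_of_lt ?_ hφ⟩
  rw [W1pNorm_sub_eq (hasWeakGradient_weakGrad hu.1.2.1) (TestFunction.hasWeakGradient φ)
    (z := pairOf hu.1) hu.1.1.coeFn_toLp hu.1.2.2.coeFn_toLp (testPair_fst_ae φ)
    (testPair_snd_ae φ), Prod.edist_eq]
  exact max_le le_self_add le_add_self

lemma mem_W01p_of_mem (hpq : p.HolderConjugate q) {z : LpPair Ω p} (hz : z ∈ sobolevPairs Ω p) :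
    ⇑z.1 ∈ W01p Ω p := by
  refine ⟨mem_W1p_of_mem hpq hz, fun δ hδ => ?_⟩
  obtain ⟨_, ⟨φ, rfl⟩, hφ⟩ := EMetric.mem_closure_iff.1
    (show z ∈ closure (LinearMap.range (testPair Ω p) : Set (LpPair Ω p)) from hz) (δ / 2)
    (ENNReal.half_pos hδ.ne')
  refine ⟨φ, ?_⟩
  rw [W1pNorm_sub_eq (hasWeakGradient_of_mem hpq hz) (TestFunction.hasWeakGradient φ)
    EventuallyEq.rfl EventuallyEq.rfl (testPair_fst_ae φ) (testPair_snd_ae φ)]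
  rw [Prod.edist_eq] at hφ
  calc _ < δ / 2 + δ / 2 :=
        ENNReal.add_lt_add ((le_max_left _ _).trans_lt hφ) ((le_max_right _ _).trans_lt hφ)
    _ = δ := ENNReal.add_halves δ

end Pairs

/-! ### Poincaré's inequality -/

section Poincare

/-- The fundamental theorem of calculus along the segment from `x` to `x + 2R e`, whose far end lies
outside the ball and hence outside the support. -/
lemma TestFunction.enorm_le_lintegral_gradient (φ : 𝓓(Ω, ℝ)) {R : ℝ} (hR : 0 < R)
    (hΩ : (Ω : Set (EuclideanSpace ℝ (Fin n))) ⊆ Metric.ball 0 R) {e : EuclideanSpace ℝ (Fin n)}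
    (he : ‖e‖ = 1) {x : EuclideanSpace ℝ (Fin n)} (hx : x ∈ Ω) :
    ‖φ x‖ₑ ≤ ∫⁻ t in Set.Ioc 0 (2 * R), ‖gradient φ (x + t • e)‖ₑ := by
  have hderiv : ∀ t : ℝ, HasDerivAt (fun t : ℝ => φ (x + t • e)) (fderiv ℝ φ (x + t • e) e) t := by
    intro t
    have h1 : HasDerivAt (fun t : ℝ => x + t • e) e t := by
      simpa using ((hasDerivAt_id t).smul_const e).const_add x
    exact (differentiableAt φ _).hasFDerivAt.comp_hasDerivAt t h1
  have hcont : Continuous fun t : ℝ => fderiv ℝ φ (x + t • e) e :=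
    (continuous_fderiv_apply φ e).comp (by fun_prop)
  have hint := intervalIntegral.integral_eq_sub_of_hasDerivAt (a := 0) (b := 2 * R)
    (fun t _ => hderiv t) (hcont.intervalIntegrable _ _)
  have hzero : φ (x + (2 * R) • e) = 0 := by
    refine image_eq_zero_of_notMem_tsupport fun h => ?_
    have h1 := hΩ (φ.tsupport_subset h)
    have h2 := hΩ hx
    rw [mem_ball_zero_iff] at h1 h2
    have h3 : ‖(2 * R) • e‖ ≤ ‖x + (2 * R) • e‖ + ‖x‖ := by
      simpa using norm_sub_le (x + (2 * R) • e) x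
    rw [norm_smul, he, Real.norm_of_nonneg (by linarith)] at h3
    linarith
  simp only [hzero, zero_smul, add_zero, zero_sub] at hint
  rw [← enorm_neg, ← hint, intervalIntegral.integral_of_le (by linarith)]
  refine (enorm_integral_le_lintegral_enorm _).trans (lintegral_mono fun t => ?_)
  rw [← inner_gradient, ← ofReal_norm, ← ofReal_norm]
  refine ENNReal.ofReal_le_ofReal ((norm_inner_le_norm _ _).trans ?_)
  rw [he, mul_one]

/-- Hölder's inequality against the constant `1`. -/
lemma lintegral_rpow_le_of_holderConjugate {α : Type*} [MeasurableSpace α] {μ : Measure α}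
    (hpq : p.HolderConjugate q) {g : α → ℝ≥0∞} (hg : AEMeasurable g μ) :
    (∫⁻ a, g a ∂μ) ^ p ≤ (∫⁻ a, g a ^ p ∂μ) * μ Set.univ ^ (p / q) := by
  have h := ENNReal.lintegral_mul_le_Lp_mul_Lq μ hpq hg (aemeasurable_const (b := (1 : ℝ≥0∞)))
  simp only [Pi.mul_apply, mul_one, ENNReal.one_rpow, lintegral_one] at h
  refine (ENNReal.rpow_le_rpow h hpq.nonneg).trans ?_
  rw [ENNReal.mul_rpow_of_nonneg _ _ hpq.nonneg, ← ENNReal.rpow_mul, ← ENNReal.rpow_mul,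
    one_div_mul_cancel hpq.ne_zero, ENNReal.rpow_one, one_div_mul_eq_div]

lemma TestFunction.lintegral_rpow_le (hpq : p.HolderConjugate q) (φ : 𝓓(Ω, ℝ)) {R : ℝ}
    (hR : 0 < R) (hΩ : (Ω : Set (EuclideanSpace ℝ (Fin n))) ⊆ Metric.ball 0 R)
    {e : EuclideanSpace ℝ (Fin n)} (he : ‖e‖ = 1) :
    ∫⁻ x in Ω, ‖φ x‖ₑ ^ p ≤
      ENNReal.ofReal (2 * R) ^ (p / q) * ENNReal.ofReal (2 * R) *
        ∫⁻ x in Ω, ‖gradient φ x‖ₑ ^ p := by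
  set c := ENNReal.ofReal (2 * R)
  have hmeas : Measurable fun z : EuclideanSpace ℝ (Fin n) × ℝ =>
      ‖gradient φ (z.1 + z.2 • e)‖ₑ ^ p := by
    have : Continuous fun z : EuclideanSpace ℝ (Fin n) × ℝ => gradient φ (z.1 + z.2 • e) :=
      (continuous_gradient φ).comp (by fun_prop)
    exact this.measurable.enorm.pow_const p
  have hpt : ∀ x ∈ Ω, ‖φ x‖ₑ ^ p ≤
      c ^ (p / q) * ∫⁻ t in Set.Ioc 0 (2 * R), ‖gradient φ (x + t • e)‖ₑ ^ p := by
    intro x hx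
    refine (ENNReal.rpow_le_rpow (enorm_le_lintegral_gradient φ hR hΩ he hx) hpq.nonneg).trans ?_
    refine (lintegral_rpow_le_of_holderConjugate hpq ?_).trans_eq ?_
    · have : Continuous fun t : ℝ => gradient φ (x + t • e) :=
        (continuous_gradient φ).comp (by fun_prop)
      exact this.measurable.enorm.aemeasurable
    · rw [mul_comm]
      simp [c]
  calc ∫⁻ x in Ω, ‖φ x‖ₑ ^ p
      ≤ ∫⁻ x in Ω, c ^ (p / q) * ∫⁻ t in Set.Ioc 0 (2 * R), ‖gradient φ (x + t • e)‖ₑ ^ p :=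
        setLIntegral_mono' Ω.isOpen.measurableSet hpt
    -- Enlarging the domain to the whole space lets Tonelli and translation invariance remove the
    -- shift `t • e`; the support of the gradient then restores `Ω`.
    _ ≤ ∫⁻ x, c ^ (p / q) * ∫⁻ t in Set.Ioc 0 (2 * R), ‖gradient φ (x + t • e)‖ₑ ^ p :=
        setLIntegral_le_lintegral _ _
    _ = c ^ (p / q) * ∫⁻ x, ∫⁻ t in Set.Ioc 0 (2 * R), ‖gradient φ (x + t • e)‖ₑ ^ p :=
        lintegral_const_mul _ hmeas.lintegral_prod_right'
    _ = c ^ (p / q) * ∫⁻ t in Set.Ioc 0 (2 * R), ∫⁻ x, ‖gradient φ (x + t • e)‖ₑ ^ p := by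
        rw [lintegral_lintegral_swap hmeas.aemeasurable]
    _ = c ^ (p / q) * ∫⁻ t in Set.Ioc 0 (2 * R), ∫⁻ x, ‖gradient φ x‖ₑ ^ p := by
        congr 1
        refine lintegral_congr fun t => ?_
        exact lintegral_add_right_eq_self (fun x => ‖gradient φ x‖ₑ ^ p) (t • e)
    _ = c ^ (p / q) * c * ∫⁻ x, ‖gradient φ x‖ₑ ^ p := by
        rw [lintegral_const, Measure.restrict_apply .univ, Set.univ_inter, Real.volume_Ioc,
          sub_zero]
        ring
    _ = c ^ (p / q) * c * ∫⁻ x in Ω, ‖gradient φ x‖ₑ ^ p := by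
        congr 1
        refine (setLIntegral_eq_of_support_subset ?_).symm
        refine Function.support_subset_iff'.2 fun x hx => ?_
        have : gradient φ x = 0 := image_eq_zero_of_notMem_tsupport fun h =>
          hx (φ.tsupport_subset (tsupport_gradient_subset φ h))
        simp [this, ENNReal.zero_rpow_of_pos hpq.pos]

/-- **Poincaré's inequality** on `W₀^{1,p}` of a bounded open set. -/
lemma exists_poincare [Fact (1 ≤ ENNReal.ofReal p)] (hpq : p.HolderConjugate q) (hn : 1 ≤ n)
    (hΩ : Bornology.IsBounded (Ω : Set (EuclideanSpace ℝ (Fin n)))) :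
    ∃ C : ℝ, 0 ≤ C ∧ ∀ z ∈ sobolevPairs Ω p, ‖z.1‖ ≤ C * ‖z.2‖ := by
  obtain ⟨R, hR, hΩR⟩ := hΩ.subset_ball_lt 0 0
  let e : EuclideanSpace ℝ (Fin n) := EuclideanSpace.single ⟨0, hn⟩ 1
  have he : ‖e‖ = 1 := by simp [e]
  set K := ENNReal.ofReal (2 * R) ^ (p / q) * ENNReal.ofReal (2 * R)
  have hK : K ≠ ∞ := ENNReal.mul_ne_top (ENNReal.rpow_ne_top_of_nonneg
    (div_nonneg hpq.nonneg hpq.symm.nonneg) ENNReal.ofReal_ne_top) ENNReal.ofReal_ne_top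
  have hK' : K ^ (1 / p) ≠ ∞ := ENNReal.rpow_ne_top_of_nonneg (one_div_nonneg.2 hpq.nonneg) hK
  refine ⟨(K ^ (1 / p)).toReal, ENNReal.toReal_nonneg, fun z hz => ?_⟩
  refine sobolevPairs_induction
    (S := {z : LpPair Ω p | ‖z.1‖ ≤ (K ^ (1 / p)).toReal * ‖z.2‖})
    (isClosed_le (by fun_prop) (by fun_prop)) (fun φ => ?_) hz
  have h := TestFunction.lintegral_rpow_le hpq φ hR hΩR he
  have hp0 : ENNReal.ofReal p ≠ 0 := by simpa using hpq.pos
  rw [Set.mem_ofPred_eq, Lp.norm_def, Lp.norm_def, eLpNorm_congr_ae (testPair_fst_ae φ),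
    eLpNorm_congr_ae (testPair_snd_ae φ), ← ENNReal.toReal_mul]
  refine ENNReal.toReal_mono (ENNReal.mul_ne_top hK' (TestFunction.memLp_gradient φ _).2.ne) ?_
  rw [eLpNorm_eq_lintegral_rpow_enorm_toReal hp0 ENNReal.ofReal_ne_top,
    eLpNorm_eq_lintegral_rpow_enorm_toReal hp0 ENNReal.ofReal_ne_top,
    ENNReal.toReal_ofReal hpq.nonneg, ← ENNReal.mul_rpow_of_nonneg _ _
      (one_div_nonneg.2 hpq.nonneg)]
  exact ENNReal.rpow_le_rpow h (one_div_nonneg.2 hpq.nonneg)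

end Poincare

/-! ### The augmented gradient `(∇u, k)` -/

section Augmented

/-- The Hilbert space `ℝⁿ × ℝ`. The density `(|γ|² + k²)^{p/2}` is the `p`-th power of the norm
of `(γ, k)` in it. -/
abbrev Augmented (n : ℕ) : Type := WithLp 2 (EuclideanSpace ℝ (Fin n) × ℝ)

instance : FiniteDimensional ℝ (Augmented n) :=
  (WithLp.prodContinuousLinearEquiv 2 ℝ (EuclideanSpace ℝ (Fin n)) ℝ).symm.toLinearEquiv
    |>.finiteDimensional

/-- The embedding `γ ↦ (γ, 0)`. -/
def augmentLeft (n : ℕ) : EuclideanSpace ℝ (Fin n) →L[ℝ] Augmented n :=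
  (WithLp.prodContinuousLinearEquiv 2 ℝ (EuclideanSpace ℝ (Fin n)) ℝ).symm.toContinuousLinearMap ∘L
    ContinuousLinearMap.inl ℝ (EuclideanSpace ℝ (Fin n)) ℝ

/-- The embedding `k ↦ (0, k)`. -/
def augmentRight (n : ℕ) : ℝ →L[ℝ] Augmented n :=
  (WithLp.prodContinuousLinearEquiv 2 ℝ (EuclideanSpace ℝ (Fin n)) ℝ).symm.toContinuousLinearMap ∘L
    ContinuousLinearMap.inr ℝ (EuclideanSpace ℝ (Fin n)) ℝ

lemma norm_augment_sq (γ : EuclideanSpace ℝ (Fin n)) (k : ℝ) :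
    ‖augmentLeft n γ + augmentRight n k‖ ^ 2 = ‖γ‖ ^ 2 + k ^ 2 := by
  simp [augmentLeft, augmentRight, WithLp.prod_norm_sq_eq_of_L2]

lemma norm_augment_rpow (γ : EuclideanSpace ℝ (Fin n)) (k : ℝ) :
    ‖augmentLeft n γ + augmentRight n k‖ ^ p = (‖γ‖ ^ 2 + k ^ 2) ^ (p / 2) := by
  rw [← norm_augment_sq, ← Real.rpow_natCast, ← Real.rpow_mul (norm_nonneg _)]
  congr 1
  push_cast
  ring

variable {α : Type*} [MeasurableSpace α] {μ : Measure α} [Fact (1 ≤ ENNReal.ofReal p)]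

/-- The element `(b, k)` of `L^p(ℝⁿ × ℝ)`. -/
def augment (b : Lp (EuclideanSpace ℝ (Fin n)) (ENNReal.ofReal p) μ)
    (k : Lp ℝ (ENNReal.ofReal p) μ) : Lp (Augmented n) (ENNReal.ofReal p) μ :=
  (augmentLeft n).compLpL (ENNReal.ofReal p) μ b + (augmentRight n).compLpL (ENNReal.ofReal p) μ k

lemma augment_ae (b : Lp (EuclideanSpace ℝ (Fin n)) (ENNReal.ofReal p) μ)
    (k : Lp ℝ (ENNReal.ofReal p) μ) :
    augment b k =ᵐ[μ] fun x => augmentLeft n (b x) + augmentRight n (k x) := by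
  filter_upwards [Lp.coeFn_add ((augmentLeft n).compLpL (ENNReal.ofReal p) μ b)
    ((augmentRight n).compLpL (ENNReal.ofReal p) μ k),
    (augmentLeft n).coeFn_compLpL b, (augmentRight n).coeFn_compLpL k] with x h1 h2 h3
  rw [augment, h1, Pi.add_apply, h2, h3]

lemma norm_augment_rpow_eq_integral (hp : 1 < p)
    (b : Lp (EuclideanSpace ℝ (Fin n)) (ENNReal.ofReal p) μ) (k : Lp ℝ (ENNReal.ofReal p) μ) :
    ‖augment b k‖ ^ p = ∫ x, (‖b x‖ ^ 2 + k x ^ 2) ^ (p / 2) ∂μ := by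
  rw [Lp.norm_rpow_eq_integral hp]
  refine integral_congr_ae ?_
  filter_upwards [augment_ae b k] with x hx
  rw [hx, norm_augment_rpow]

lemma integrable_augment_rpow (hp : 1 < p)
    (b : Lp (EuclideanSpace ℝ (Fin n)) (ENNReal.ofReal p) μ) (k : Lp ℝ (ENNReal.ofReal p) μ) :
    Integrable (fun x => (‖b x‖ ^ 2 + k x ^ 2) ^ (p / 2)) μ := by
  refine (MemLp.integrable_norm_rpow_ofReal hp (Lp.memLp (augment b k))).congr ?_
  filter_upwards [augment_ae b k] with x hx
  rw [hx, norm_augment_rpow]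

lemma augment_zero_right (b : Lp (EuclideanSpace ℝ (Fin n)) (ENNReal.ofReal p) μ) :
    augment b 0 = (augmentLeft n).compLpL (ENNReal.ofReal p) μ b := by
  simp [augment]

lemma norm_augment_zero_right (b : Lp (EuclideanSpace ℝ (Fin n)) (ENNReal.ofReal p) μ) : ‖augment b 0‖ = ‖b‖ := by
  have key : ∀ᵐ x ∂μ, ‖augment b 0 x‖ = ‖b x‖ := by
    filter_upwards [augment_ae b (0 : Lp ℝ (ENNReal.ofReal p) μ),
      Lp.coeFn_zero ℝ (ENNReal.ofReal p) μ] with x hx h0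
    have h := norm_augment_sq (b x) 0
    rw [hx, h0, Pi.zero_apply]
    exact (pow_left_inj₀ (norm_nonneg _) (norm_nonneg _) two_ne_zero).1 (by simpa using h)
  exact le_antisymm (Lp.norm_le_norm_of_ae_le (key.mono fun x hx => hx.le))
    (Lp.norm_le_norm_of_ae_le (key.mono fun x hx => hx.ge))

lemma norm_augment_mono {b b' : Lp (EuclideanSpace ℝ (Fin n)) (ENNReal.ofReal p) μ}
    {k k' : Lp ℝ (ENNReal.ofReal p) μ}
    (h : ∀ᵐ x ∂μ, ‖b x‖ ^ 2 + k x ^ 2 ≤ ‖b' x‖ ^ 2 + k' x ^ 2) :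
    ‖augment b k‖ ≤ ‖augment b' k'‖ := by
  refine Lp.norm_le_norm_of_ae_le ?_
  filter_upwards [h, augment_ae b k, augment_ae b' k'] with x hx h1 h2
  rw [← norm_augment_sq, ← norm_augment_sq, ← h1, ← h2] at hx
  exact (sq_le_sq₀ (norm_nonneg _) (norm_nonneg _)).1 hx

/-- Adding a small multiple of `k` in the orthogonal direction changes `‖·‖ ^ p` by `o(s)`. -/
lemma exists_norm_augment_smul_rpow_le (hp : 1 < p)
    (b : Lp (EuclideanSpace ℝ (Fin n)) (ENNReal.ofReal p) μ) (k : Lp ℝ (ENNReal.ofReal p) μ) :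
    ∃ C r : ℝ, 1 < r ∧ ∀ s : ℝ, 0 < s → s ≤ 1 →
      ‖augment b (s • k)‖ ^ p ≤ ‖augment b 0‖ ^ p + C * s ^ r := by
  have hb : ‖augment b 0‖ ^ p = ∫ x, (‖b x‖ ^ 2) ^ (p / 2) ∂μ := by
    rw [norm_augment_rpow_eq_integral hp]
    refine integral_congr_ae ?_
    filter_upwards [Lp.coeFn_zero ℝ (ENNReal.ofReal p) μ] with x hx
    rw [hx]
    simp
  have hbi : Integrable (fun x => (‖b x‖ ^ 2) ^ (p / 2)) μ := by
    refine (integrable_augment_rpow hp b 0).congr ?_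
    filter_upwards [Lp.coeFn_zero ℝ (ENNReal.ofReal p) μ] with x hx
    rw [hx]
    simp
  -- For `p ≤ 2` the power `t ↦ t ^ (p / 2)` is subadditive, which gives the exponent `r = p`. For
  -- `p ≥ 2` it is convex, and `|b|² + s² k²` is the combination of `|b|²` and `|b|² + k²` with
  -- weight `s²`, which gives `r = 2`.
  rcases le_total p 2 with hp2 | hp2
  · have hki : Integrable (fun x => (k x ^ 2) ^ (p / 2)) μ := by
      refine (integrable_augment_rpow (n := n) hp 0 k).congr ?_
      filter_upwards [Lp.coeFn_zero (EuclideanSpace ℝ (Fin n)) (ENNReal.ofReal p) μ] with x hx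
      rw [hx]
      simp
    refine ⟨∫ x, (k x ^ 2) ^ (p / 2) ∂μ, p, hp, fun s hs _ => ?_⟩
    rw [norm_augment_rpow_eq_integral hp, hb, ← integral_mul_const,
      ← integral_add hbi (hki.mul_const _)]
    refine integral_mono_ae (integrable_augment_rpow hp _ _) (hbi.add (hki.mul_const _)) ?_
    filter_upwards [Lp.coeFn_smul s k] with x hx
    simp only [hx, Pi.smul_apply, smul_eq_mul]
    refine (Real.rpow_add_le_add_rpow (by positivity) (by positivity) (by linarith)
      (by linarith)).trans_eq ?_
    congr 1
    rw [mul_pow, Real.mul_rpow (by positivity) (by positivity), mul_comm]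
    congr 1
    rw [← Real.rpow_natCast, ← Real.rpow_mul hs.le]
    congr 1
    push_cast
    ring
  · refine ⟨‖augment b k‖ ^ p, 2, by norm_num, fun s hs hs1 => ?_⟩
    rw [norm_augment_rpow_eq_integral hp b (s • k), norm_augment_rpow_eq_integral hp b k, hb,
      ← integral_mul_const, ← integral_add hbi ((integrable_augment_rpow hp _ _).mul_const _)]
    refine integral_mono_ae (integrable_augment_rpow hp _ _)
      (hbi.add ((integrable_augment_rpow hp _ _).mul_const _)) ?_
    filter_upwards [Lp.coeFn_smul s k] with x hx
    simp only [hx, Pi.smul_apply, smul_eq_mul]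
    have hs2 : s ^ 2 ≤ 1 := by nlinarith
    have hconv := (convexOn_rpow (by linarith : 1 ≤ p / 2)).2
      (Set.mem_Ici.2 (by positivity : 0 ≤ ‖b x‖ ^ 2))
      (Set.mem_Ici.2 (by positivity : 0 ≤ ‖b x‖ ^ 2 + k x ^ 2))
      (sub_nonneg.2 hs2) (sq_nonneg s) (by ring)
    simp only [smul_eq_mul] at hconv
    have e : (1 - s ^ 2) * ‖b x‖ ^ 2 + s ^ 2 * (‖b x‖ ^ 2 + k x ^ 2) = ‖b x‖ ^ 2 + (s * k x) ^ 2 := by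
      ring
    rw [e] at hconv
    have h0 : 0 ≤ (‖b x‖ ^ 2) ^ (p / 2) := by positivity
    have : s ^ (2 : ℝ) = s ^ 2 := Real.rpow_two s
    rw [this]
    nlinarith [mul_nonneg (sq_nonneg s) h0]

end Augmented

/-! ### The energies as functionals on pairs -/

section Energies

lemma memLp_const_of_isBounded (hΩ : Bornology.IsBounded (Ω : Set (EuclideanSpace ℝ (Fin n))))
    (c : ℝ) (r : ℝ≥0∞) : MemLp (fun _ : EuclideanSpace ℝ (Fin n) => c) r (volume.restrict Ω) := by
  have : IsFiniteMeasure (volume.restrict (Ω : Set (EuclideanSpace ℝ (Fin n)))) :=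
    ⟨by simpa using hΩ.measure_lt_top⟩
  exact memLp_const c

/-- The constant `1` in `L^p` of a bounded open set. -/
def oneLp (hΩ : Bornology.IsBounded (Ω : Set (EuclideanSpace ℝ (Fin n)))) (p : ℝ) :
    Lp ℝ (ENNReal.ofReal p) (volume.restrict (Ω : Set (EuclideanSpace ℝ (Fin n)))) :=
  (memLp_const_of_isBounded hΩ 1 _).toLp

lemma oneLp_ae (hΩ : Bornology.IsBounded (Ω : Set (EuclideanSpace ℝ (Fin n)))) :
    oneLp hΩ p =ᵐ[volume.restrict Ω] fun _ => (1 : ℝ) :=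
  (memLp_const_of_isBounded hΩ 1 _).coeFn_toLp

/-- This places the unregularized functional in the same family, at `ε = 0`. -/
lemma energy_eq_regEnergy_zero (f u : EuclideanSpace ℝ (Fin n) → ℝ) :
    energy Ω p f u = regEnergy Ω 0 p f u := by
  rw [energy, regEnergy, ← integral_const_mul]
  congr 1
  refine integral_congr_ae (Eventually.of_forall fun x => ?_)
  have : (‖weakGrad Ω u x‖ ^ 2) ^ (p / 2) = ‖weakGrad Ω u x‖ ^ p := by
    rw [← Real.rpow_natCast, ← Real.rpow_mul (norm_nonneg _)]
    congr 1
    push_cast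
    ring
  simp only [H]
  rw [zero_pow two_ne_zero, mul_zero, add_zero, this]
  ring

variable [Fact (1 ≤ ENNReal.ofReal p)]

/-- The operator `(u, ∇u) ↦ (∇u, 0)`. -/
def gradOperator (Ω : TopologicalSpace.Opens (EuclideanSpace ℝ (Fin n))) (p : ℝ)
    [Fact (1 ≤ ENNReal.ofReal p)] : sobolevPairs Ω p →L[ℝ]
      Lp (Augmented n) (ENNReal.ofReal p) (volume.restrict (Ω : Set (EuclideanSpace ℝ (Fin n)))) :=
  (augmentLeft n).compLpL (ENNReal.ofReal p) _ ∘L ContinuousLinearMap.snd ℝ _ _ ∘L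
    (sobolevPairs Ω p).subtypeL

/-- The element `(0, k)` of `L^p(ℝⁿ × ℝ)`. -/
def shift {α : Type*} [MeasurableSpace α] {μ : Measure α} (n : ℕ) (k : Lp ℝ (ENNReal.ofReal p) μ) :
    Lp (Augmented n) (ENNReal.ofReal p) μ :=
  (augmentRight n).compLpL (ENNReal.ofReal p) μ k

lemma gradOperator_add_shift (z : sobolevPairs Ω p)
    (k : Lp ℝ (ENNReal.ofReal p) (volume.restrict (Ω : Set (EuclideanSpace ℝ (Fin n))))) :
    gradOperator Ω p z + shift n k = augment z.1.2 k := rfl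

lemma exists_norm_le_gradOperator (hpq : p.HolderConjugate q) (hn : 1 ≤ n)
    (hΩ : Bornology.IsBounded (Ω : Set (EuclideanSpace ℝ (Fin n)))) :
    ∃ C : ℝ, 0 ≤ C ∧ ∀ z, ‖z‖ ≤ C * ‖gradOperator Ω p z‖ := by
  obtain ⟨C, hC, h⟩ := exists_poincare hpq hn hΩ
  refine ⟨max C 1, by positivity, fun z => ?_⟩
  have e : ‖gradOperator Ω p z‖ = ‖z.1.2‖ := by
    rw [← norm_augment_zero_right, augment_zero_right]
    rfl
  rw [e, Submodule.coe_norm, Prod.norm_def]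
  refine max_le ((h z.1 z.2).trans ?_) ?_
  · gcongr
    exact le_max_left _ _
  · exact le_mul_of_one_le_left (norm_nonneg _) (le_max_right _ _)

/-- The functional `(u, ∇u) ↦ ∫ f u`. -/
def loadFunctional (hpq : p.HolderConjugate q) {f : EuclideanSpace ℝ (Fin n) → ℝ}
    (hf : MemLp f (ENNReal.ofReal q) (volume.restrict Ω)) : sobolevPairs Ω p →L[ℝ] ℝ :=
  integralPairing hpq hf ∘L ContinuousLinearMap.fst ℝ _ _ ∘L (sobolevPairs Ω p).subtypeL

lemma loadFunctional_apply (hpq : p.HolderConjugate q) {f : EuclideanSpace ℝ (Fin n) → ℝ}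
    (hf : MemLp f (ENNReal.ofReal q) (volume.restrict Ω)) (z : sobolevPairs Ω p) :
    loadFunctional hpq hf z = integralPairing hpq hf z.1.1 := rfl

/-- The pair `(u, ∇u)` of an element of `W₀^{1,p}(Ω)`. -/
def toSobolevPairs {u : EuclideanSpace ℝ (Fin n) → ℝ} (hu : u ∈ W01p Ω p) : sobolevPairs Ω p :=
  ⟨pairOf hu.1, pairOf_mem hu⟩

lemma toSobolevPairs_coe (hpq : p.HolderConjugate q) (z : sobolevPairs Ω p) :
    toSobolevPairs (mem_W01p_of_mem hpq z.2) = z := by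
  refine Subtype.ext (Prod.ext (Lp.toLp_coeFn z.1.1 (mem_W01p_of_mem hpq z.2).1.1) (Lp.ext ?_))
  exact ((mem_W01p_of_mem hpq z.2).1.2.2.coeFn_toLp).trans (hasWeakGradient_of_mem hpq z.2).weakGrad_ae_eq

lemma toSobolevPairs_fst_ae {u : EuclideanSpace ℝ (Fin n) → ℝ} (hu : u ∈ W01p Ω p) :
    (toSobolevPairs hu).1.1 =ᵐ[volume.restrict Ω] u :=
  hu.1.1.coeFn_toLp

lemma W1pNorm_sub_eq_of_mem (hpq : p.HolderConjugate q) (z w : sobolevPairs Ω p) :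
    W1pNorm Ω p (⇑z.1.1 - ⇑w.1.1) = edist z.1.1 w.1.1 + edist z.1.2 w.1.2 :=
  W1pNorm_sub_eq (hasWeakGradient_of_mem hpq z.2) (hasWeakGradient_of_mem hpq w.2)
    EventuallyEq.rfl EventuallyEq.rfl EventuallyEq.rfl EventuallyEq.rfl

/-- The functional on pairs corresponding to `regEnergy`. -/
def pairEnergy (hΩ : Bornology.IsBounded (Ω : Set (EuclideanSpace ℝ (Fin n))))
    (hpq : p.HolderConjugate q) {f : EuclideanSpace ℝ (Fin n) → ℝ}
    (hf : MemLp f (ENNReal.ofReal q) (volume.restrict Ω)) (ε : ℝ) : sobolevPairs Ω p → ℝ :=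
  powFunctional p (gradOperator Ω p) (shift n ((chi p * ε) • oneLp hΩ p)) (loadFunctional hpq hf)

lemma regEnergy_eq (hΩ : Bornology.IsBounded (Ω : Set (EuclideanSpace ℝ (Fin n))))
    (hpq : p.HolderConjugate q) {f : EuclideanSpace ℝ (Fin n) → ℝ}
    (hf : MemLp f (ENNReal.ofReal q) (volume.restrict Ω)) (ε : ℝ)
    {u : EuclideanSpace ℝ (Fin n) → ℝ} (hu : u ∈ W01p Ω p) :
    regEnergy Ω ε p f u = pairEnergy hΩ hpq hf ε (toSobolevPairs hu) := by
  -- Idempotence of the cut-off turns `χ ε²` into the square of the shift `χ ε`.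
  have hchi : chi p ^ 2 = chi p := by unfold chi; split_ifs <;> norm_num
  rw [regEnergy, pairEnergy, powFunctional, gradOperator_add_shift,
    norm_augment_rpow_eq_integral hpq.lt, ← integral_const_mul, loadFunctional_apply,
    integralPairing_apply]
  congr 1
  · refine integral_congr_ae ?_
    filter_upwards [hu.1.2.2.coeFn_toLp, Lp.coeFn_smul (chi p * ε) (oneLp hΩ p), oneLp_ae (p := p) hΩ]
      with x h1 h2 h3
    have h1' : (toSobolevPairs hu).1.2 x = weakGrad Ω u x := h1
    rw [h1', h2, Pi.smul_apply, h3, H, smul_eq_mul, mul_one, mul_pow, hchi]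
    ring
  · refine integral_congr_ae ?_
    filter_upwards [toSobolevPairs_fst_ae hu] with x hx
    rw [hx]
    simp

lemma isMinimizer_regEnergy_iff (hΩ : Bornology.IsBounded (Ω : Set (EuclideanSpace ℝ (Fin n))))
    (hpq : p.HolderConjugate q) {f : EuclideanSpace ℝ (Fin n) → ℝ}
    (hf : MemLp f (ENNReal.ofReal q) (volume.restrict Ω)) (ε : ℝ)
    {u : EuclideanSpace ℝ (Fin n) → ℝ} (hu : u ∈ W01p Ω p) :
    IsMinimizer Ω p (regEnergy Ω ε p f) u ↔
      ∀ w, pairEnergy hΩ hpq hf ε (toSobolevPairs hu) ≤ pairEnergy hΩ hpq hf ε w := by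
  constructor
  · rintro ⟨_, h⟩ w
    have := h (mem_W01p_of_mem hpq w.2)
    rwa [Set.mem_ofPred_eq, regEnergy_eq hΩ hpq hf ε hu,
      regEnergy_eq hΩ hpq hf ε (mem_W01p_of_mem hpq w.2), toSobolevPairs_coe hpq] at this
  · refine fun h => ⟨hu, fun v hv => ?_⟩
    rw [Set.mem_ofPred_eq, regEnergy_eq hΩ hpq hf ε hu, regEnergy_eq hΩ hpq hf ε hv]
    exact h _

end Energies

/-! ### Smooth approximation of `√(φ² + ψ²)` -/

section SmoothModulus

lemma sq_add_sq_add_sq_pos (a b : ℝ) {δ : ℝ} (hδ : 0 < δ) : 0 < a ^ 2 + b ^ 2 + δ ^ 2 := by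
  positivity

lemma support_smoothModulus_subset (φ ψ : EuclideanSpace ℝ (Fin n) → ℝ) {δ : ℝ} (hδ : 0 < δ) :
    tsupport (fun x => √(φ x ^ 2 + ψ x ^ 2 + δ ^ 2) - δ) ⊆ tsupport φ ∪ tsupport ψ := by
  rw [tsupport, tsupport, tsupport, ← closure_union]
  refine closure_mono (Function.support_subset_iff'.2 fun x hx => ?_)
  simp only [Set.mem_union, Function.mem_support, not_or, not_not] at hx
  simp [hx.1, hx.2, Real.sqrt_sq hδ.le]

/-- The test function `√(φ² + ψ² + δ²) - δ`, a smooth approximation of `√(φ² + ψ²)`. -/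
def smoothModulus (φ ψ : 𝓓(Ω, ℝ)) {δ : ℝ} (hδ : 0 < δ) : 𝓓(Ω, ℝ) where
  toFun x := √(φ x ^ 2 + ψ x ^ 2 + δ ^ 2) - δ
  contDiff' := (((φ.contDiff.pow 2).add (ψ.contDiff.pow 2)).add contDiff_const).sqrt
    (fun _ => (sq_add_sq_add_sq_pos _ _ hδ).ne') |>.sub contDiff_const
  hasCompactSupport' := (φ.hasCompactSupport.union ψ.hasCompactSupport).of_isClosed_subset
    (isClosed_tsupport _) (support_smoothModulus_subset φ ψ hδ)
  tsupport_subset' := (support_smoothModulus_subset φ ψ hδ).trans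
    (Set.union_subset φ.tsupport_subset ψ.tsupport_subset)

lemma smoothModulus_apply (φ ψ : 𝓓(Ω, ℝ)) {δ : ℝ} (hδ : 0 < δ) (x : EuclideanSpace ℝ (Fin n)) :
    smoothModulus φ ψ hδ x = √(φ x ^ 2 + ψ x ^ 2 + δ ^ 2) - δ := rfl

lemma le_smoothModulus (φ ψ : 𝓓(Ω, ℝ)) {δ : ℝ} (hδ : 0 < δ) (x : EuclideanSpace ℝ (Fin n)) :
    max |φ x| |ψ x| - δ ≤ smoothModulus φ ψ hδ x := by
  rw [smoothModulus_apply]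
  refine sub_le_sub_right (max_le ?_ ?_) δ
  all_goals
    refine Real.abs_le_sqrt ?_
    nlinarith [sq_nonneg (φ x), sq_nonneg (ψ x), sq_nonneg δ]

/-- The gradient is `(φ ∇φ + ψ ∇ψ) / r` with `r² = φ² + ψ² + δ²`, so this is Cauchy–Schwarz with the
factor `(φ² + ψ²) / r² ≤ 1`. -/
lemma norm_gradient_smoothModulus_sq_le (φ ψ : 𝓓(Ω, ℝ)) {δ : ℝ} (hδ : 0 < δ)
    (x : EuclideanSpace ℝ (Fin n)) :
    ‖gradient (smoothModulus φ ψ hδ) x‖ ^ 2 ≤ ‖gradient φ x‖ ^ 2 + ‖gradient ψ x‖ ^ 2 := by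
  set r := √(φ x ^ 2 + ψ x ^ 2 + δ ^ 2) with hr
  have hpos := sq_add_sq_add_sq_pos (φ x) (ψ x) hδ
  have hr0 : 0 < r := Real.sqrt_pos.2 hpos
  have hr2 : r ^ 2 = φ x ^ 2 + ψ x ^ 2 + δ ^ 2 := Real.sq_sqrt hpos.le
  have hd : HasFDerivAt (smoothModulus φ ψ hδ)
      (r⁻¹ • (φ x • fderiv ℝ φ x + ψ x • fderiv ℝ ψ x)) x := by
    have h1 := ((((TestFunction.differentiableAt φ x).hasFDerivAt.pow 2).add
      ((TestFunction.differentiableAt ψ x).hasFDerivAt.pow 2)).add_const (δ ^ 2)).sqrt hpos.ne'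
    refine (h1.sub_const δ).congr_fderiv ?_
    simp only [Pi.add_apply]
    rw [← hr]
    ext v
    simp
    field_simp
  have hg : gradient (smoothModulus φ ψ hδ) x =
      r⁻¹ • (φ x • gradient φ x + ψ x • gradient ψ x) := by
    simp only [gradient, hd.fderiv, map_smul, map_add]
  rw [hg, norm_smul, mul_pow, Real.norm_of_nonneg (by positivity), inv_pow, inv_mul_le_iff₀
    (by positivity), hr2]
  set a := ‖gradient φ x‖
  set b := ‖gradient ψ x‖
  have h1 : ‖φ x • gradient φ x + ψ x • gradient ψ x‖ ≤ |φ x| * a + |ψ x| * b := by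
    refine (norm_add_le _ _).trans_eq ?_
    rw [norm_smul, norm_smul, Real.norm_eq_abs, Real.norm_eq_abs]
  have h2 : ‖φ x • gradient φ x + ψ x • gradient ψ x‖ ^ 2 ≤ (|φ x| * a + |ψ x| * b) ^ 2 :=
    pow_le_pow_left₀ (norm_nonneg _) h1 2
  nlinarith [sq_nonneg (|φ x| * b - |ψ x| * a), sq_abs (φ x), sq_abs (ψ x), sq_nonneg (δ * a),
    sq_nonneg (δ * b)]

end SmoothModulus

/-! ### Sign of the minimizers -/

section Sign

variable {α : Type*} [MeasurableSpace α] {μ : Measure α}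

lemma integrable_mul_of_lp (hpq : p.HolderConjugate q) {f : α → ℝ}
    (hf : MemLp f (ENNReal.ofReal q) μ) (w : Lp ℝ (ENNReal.ofReal p) μ) :
    Integrable (fun x => f x * w x) μ := by
  have := hpq.symm.ennrealOfReal
  exact hf.integrable_mul (Lp.memLp w)

variable [Fact (1 ≤ ENNReal.ofReal p)]

lemma integralPairing_eq_integral_mul (hpq : p.HolderConjugate q) {f : α → ℝ}
    (hf : MemLp f (ENNReal.ofReal q) μ) (w : Lp ℝ (ENNReal.ofReal p) μ) :
    integralPairing hpq hf w = ∫ x, f x * w x ∂μ := by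
  rw [integralPairing_apply]
  simp

lemma sign_mul_integralPairing_mono (hpq : p.HolderConjugate q) {f : α → ℝ}
    (hf : MemLp f (ENNReal.ofReal q) μ) {σ : ℝ} (hσ : ∀ᵐ x ∂μ, 0 < σ * f x)
    {v w : Lp ℝ (ENNReal.ofReal p) μ} (h : ∀ᵐ x ∂μ, v x ≤ w x) :
    σ * integralPairing hpq hf v ≤ σ * integralPairing hpq hf w := by
  rw [integralPairing_eq_integral_mul, integralPairing_eq_integral_mul, ← integral_const_mul,
    ← integral_const_mul]
  refine integral_mono_ae ((integrable_mul_of_lp hpq hf v).const_mul σ)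
    ((integrable_mul_of_lp hpq hf w).const_mul σ) ?_
  filter_upwards [hσ, h] with x h1 h2
  nlinarith

/-- Comparison of a minimizer with the competitors `σ √(u² + ψ²)`. -/
lemma powFunctional_le_of_minimizer
    (hΩ : Bornology.IsBounded (Ω : Set (EuclideanSpace ℝ (Fin n)))) (hpq : p.HolderConjugate q)
    {f : EuclideanSpace ℝ (Fin n) → ℝ} (hf : MemLp f (ENNReal.ofReal q) (volume.restrict Ω))
    {σ : ℝ} (hσ2 : σ ^ 2 = 1) (hσ : ∀ᵐ x ∂(volume.restrict Ω), 0 < σ * f x)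
    {k k' : Lp ℝ (ENNReal.ofReal p) (volume.restrict (Ω : Set (EuclideanSpace ℝ (Fin n))))}
    (ψ : 𝓓(Ω, ℝ))
    (hk : ∀ᵐ x ∂(volume.restrict Ω), k x ^ 2 + ‖gradient ψ x‖ ^ 2 ≤ k' x ^ 2)
    {z : sobolevPairs Ω p}
    (hz : ∀ w, powFunctional p (gradOperator Ω p) (shift n k) (loadFunctional hpq hf) z ≤
      powFunctional p (gradOperator Ω p) (shift n k) (loadFunctional hpq hf) w) :
    powFunctional p (gradOperator Ω p) (shift n k) (loadFunctional hpq hf) z ≤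
      1 / p * ‖augment z.1.2 k'‖ ^ p -
        σ * integralPairing hpq hf (|z.1.1| ⊔ |(testPair Ω p ψ).1|) := by
  set J := powFunctional p (gradOperator Ω p) (shift n k) (loadFunctional hpq hf)
  set ℓ := integralPairing hpq hf
  obtain ⟨φ, hφ⟩ := exists_testPair_tendsto z.2
  have hδ : ∀ j : ℕ, (0 : ℝ) < 1 / ((j : ℝ) + 1) := fun j => Nat.one_div_pos_of_nat
  -- The competitors are built from test functions approximating `z`, and only the resulting
  -- inequality passes to the limit. So neither `|u|` nor `√(u² + ψ²)` has to be placed in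
  -- `W₀^{1,p}`. The smoothing costs `1 / (j + 1)` times a fixed integral.
  let W : ℕ → 𝓓(Ω, ℝ) := fun j => smoothModulus (φ j) ψ (hδ j)
  have hJ : ∀ j, J z ≤ 1 / p * ‖augment (testPair Ω p (φ j)).2 k'‖ ^ p -
      (σ * ℓ (|(testPair Ω p (φ j)).1| ⊔ |(testPair Ω p ψ).1|) -
        1 / ((j : ℝ) + 1) * (σ * ℓ (oneLp hΩ p))) := by
    intro j
    refine (hz ⟨testPair Ω p (σ • W j), testPair_mem _⟩).trans ?_
    have h1 : ‖augment (testPair Ω p (σ • W j)).2 k‖ ≤ ‖augment (testPair Ω p (φ j)).2 k'‖ := by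
      refine norm_augment_mono ?_
      filter_upwards [hk, testPair_snd_ae (p := p) (σ • W j), testPair_snd_ae (p := p) (φ j)]
        with x h1 h2 h3
      rw [h2, h3, TestFunction.gradient_smul, Pi.smul_apply, norm_smul, mul_pow,
        Real.norm_eq_abs, sq_abs, hσ2, one_mul]
      have := norm_gradient_smoothModulus_sq_le (φ j) ψ (hδ j) x
      linarith
    have h2 : σ * ℓ (|(testPair Ω p (φ j)).1| ⊔ |(testPair Ω p ψ).1|) -
        1 / ((j : ℝ) + 1) * (σ * ℓ (oneLp hΩ p)) ≤ ℓ (testPair Ω p (σ • W j)).1 := by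
      have e1 : ℓ (testPair Ω p (σ • W j)).1 = σ * ℓ (testPair Ω p (W j)).1 := by
        rw [map_smul, Prod.smul_fst, map_smul, smul_eq_mul]
      have e2 : σ * ℓ (|(testPair Ω p (φ j)).1| ⊔ |(testPair Ω p ψ).1|) -
          1 / ((j : ℝ) + 1) * (σ * ℓ (oneLp hΩ p)) =
          σ * ℓ (|(testPair Ω p (φ j)).1| ⊔ |(testPair Ω p ψ).1| -
            (1 / ((j : ℝ) + 1)) • oneLp hΩ p) := by
        rw [map_sub, map_smul, smul_eq_mul]
        ring
      rw [e1, e2]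
      refine sign_mul_integralPairing_mono hpq hf hσ ?_
      filter_upwards [Lp.coeFn_sub (|(testPair Ω p (φ j)).1| ⊔ |(testPair Ω p ψ).1|)
          ((1 / ((j : ℝ) + 1)) • oneLp hΩ p),
        Lp.coeFn_sup |(testPair Ω p (φ j)).1| |(testPair Ω p ψ).1|,
        Lp.coeFn_abs (testPair Ω p (φ j)).1, Lp.coeFn_abs (testPair Ω p ψ).1,
        Lp.coeFn_smul (1 / ((j : ℝ) + 1)) (oneLp hΩ p), oneLp_ae (p := p) hΩ,
        testPair_fst_ae (p := p) (φ j), testPair_fst_ae (p := p) ψ,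
        testPair_fst_ae (p := p) (W j)] with x h1 h2 h3 h4 h5 h6 h7 h8 h9
      rw [h1, Pi.sub_apply, h2, Pi.sup_apply, h3, h4, h5, Pi.smul_apply, h6, h7, h8, h9,
        smul_eq_mul, mul_one]
      exact le_smoothModulus (φ j) ψ (hδ j) x
    have h3 : ‖augment (testPair Ω p (σ • W j)).2 k‖ ^ p ≤
        ‖augment (testPair Ω p (φ j)).2 k'‖ ^ p :=
      Real.rpow_le_rpow (norm_nonneg _) h1 hpq.nonneg
    have h4 := mul_le_mul_of_nonneg_left h3 (one_div_nonneg.2 hpq.nonneg)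
    change 1 / p * ‖augment (testPair Ω p (σ • W j)).2 k‖ ^ p - ℓ (testPair Ω p (σ • W j)).1 ≤ _
    linarith
  have hlim : Tendsto (fun j : ℕ => 1 / p * ‖augment (testPair Ω p (φ j)).2 k'‖ ^ p -
      (σ * ℓ (|(testPair Ω p (φ j)).1| ⊔ |(testPair Ω p ψ).1|) -
        1 / ((j : ℝ) + 1) * (σ * ℓ (oneLp hΩ p)))) atTop
      (𝓝 (1 / p * ‖augment z.1.2 k'‖ ^ p -
        (σ * ℓ (|z.1.1| ⊔ |(testPair Ω p ψ).1|) - 0 * (σ * ℓ (oneLp hΩ p))))) := by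
    have t1 : Tendsto (fun j => (testPair Ω p (φ j)).1) atTop (𝓝 z.1.1) :=
      (continuous_fst.tendsto _).comp hφ
    have t2 : Tendsto (fun j => (testPair Ω p (φ j)).2) atTop (𝓝 z.1.2) :=
      (continuous_snd.tendsto _).comp hφ
    have t3 : Tendsto (fun j => augment (testPair Ω p (φ j)).2 k') atTop (𝓝 (augment z.1.2 k')) :=
      ((((augmentLeft n).compLpL (ENNReal.ofReal p) _).continuous.tendsto _).comp t2).add_const _
    have t4 : Tendsto (fun j => |(testPair Ω p (φ j)).1| ⊔ |(testPair Ω p ψ).1|) atTop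
        (𝓝 (|z.1.1| ⊔ |(testPair Ω p ψ).1|)) := by
      have : Continuous fun w : Lp ℝ (ENNReal.ofReal p)
          (volume.restrict (Ω : Set (EuclideanSpace ℝ (Fin n)))) =>
            |w| ⊔ |(testPair Ω p ψ).1| := by
        simp only [abs]
        exact (continuous_id.sup continuous_neg).sup continuous_const
      exact (this.tendsto _).comp t1
    exact ((t3.norm.rpow_const (Or.inr hpq.nonneg)).const_mul _).sub
      ((((ℓ.continuous.tendsto _).comp t4).const_mul σ).sub
        (tendsto_one_div_add_atTop_nhds_zero_nat.mul_const _))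
  have := ge_of_tendsto' hlim hJ
  simpa using this

/-- A minimizer has the sign of the load. -/
lemma abs_eq_sign_mul_of_minimizer
    (hΩ : Bornology.IsBounded (Ω : Set (EuclideanSpace ℝ (Fin n)))) (hpq : p.HolderConjugate q)
    {f : EuclideanSpace ℝ (Fin n) → ℝ} (hf : MemLp f (ENNReal.ofReal q) (volume.restrict Ω))
    {σ : ℝ} (hσ2 : σ ^ 2 = 1) (hσ : ∀ᵐ x ∂(volume.restrict Ω), 0 < σ * f x)
    {k : Lp ℝ (ENNReal.ofReal p) (volume.restrict (Ω : Set (EuclideanSpace ℝ (Fin n))))}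
    {z : sobolevPairs Ω p}
    (hz : ∀ w, powFunctional p (gradOperator Ω p) (shift n k) (loadFunctional hpq hf) z ≤
      powFunctional p (gradOperator Ω p) (shift n k) (loadFunctional hpq hf) w) :
    ∀ᵐ x ∂(volume.restrict Ω), |z.1.1 x| = σ * z.1.1 x := by
  have hgrad0 : gradient (0 : 𝓓(Ω, ℝ)) = 0 := by
    simpa using TestFunction.gradient_smul 0 (0 : 𝓓(Ω, ℝ))
  -- With `ψ = 0` and `k' = k` the gradient terms cancel, leaving `∫ σ f |u| ≤ ∫ f u`; the reverse
  -- inequality holds pointwise, so equality holds almost everywhere.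
  have h := powFunctional_le_of_minimizer hΩ hpq hf hσ2 hσ (k' := k) 0
    (Eventually.of_forall fun x => by rw [hgrad0]; simp) hz
  rw [powFunctional, gradOperator_add_shift, loadFunctional_apply, map_zero, Prod.fst_zero,
    abs_zero, sup_of_le_left (abs_nonneg _)] at h
  have h1 : σ * integralPairing hpq hf |z.1.1| ≤ integralPairing hpq hf z.1.1 := by linarith
  rw [integralPairing_eq_integral_mul, integralPairing_eq_integral_mul, ← integral_const_mul] at h1
  have i1 := (integrable_mul_of_lp hpq hf |z.1.1|).const_mul σ
  have i2 := integrable_mul_of_lp hpq hf z.1.1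
  have hnn : 0 ≤ᵐ[volume.restrict Ω] fun x => σ * (f x * |z.1.1| x) - f x * z.1.1 x := by
    filter_upwards [hσ, Lp.coeFn_abs z.1.1] with x h2 h3
    rw [h3]
    have h4 : σ * z.1.1 x ≤ |z.1.1 x| := by
      have : |σ| = 1 := by rwa [← sq_eq_sq₀ (abs_nonneg _) zero_le_one, sq_abs, one_pow]
      calc σ * z.1.1 x ≤ |σ * z.1.1 x| := le_abs_self _
        _ = |z.1.1 x| := by rw [abs_mul, this, one_mul]
    have h5 : f x * z.1.1 x = σ * f x * (σ * z.1.1 x) := by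
      linear_combination (-(f x * z.1.1 x)) * hσ2
    simp only [Pi.zero_apply]
    rw [h5]
    nlinarith
  have hint : ∫ x in Ω, (σ * (f x * |z.1.1| x) - f x * z.1.1 x) = 0 := by
    refine le_antisymm ?_ (integral_nonneg_of_ae hnn)
    rw [integral_sub i1 i2]
    linarith
  filter_upwards [(integral_eq_zero_iff_of_nonneg_ae hnn (i1.sub i2)).1 hint, hσ,
    Lp.coeFn_abs z.1.1] with x h2 h3 h4
  rw [h4, Pi.zero_apply] at h2
  have : σ * f x * (|z.1.1 x| - σ * z.1.1 x) = 0 := by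
    linear_combination h2 - f x * z.1.1 x * hσ2
  exact sub_eq_zero.1 ((mul_eq_zero.1 this).resolve_left h3.ne')

end Sign

/-! ### Non-vanishing of the minimizer of `I` -/

section StrictSign

variable [Fact (1 ≤ ENNReal.ofReal p)]

/-- The load does not act on the zero set of a minimizer. -/
lemma integral_zeroSet_nonpos_of_minimizer
    (hΩ : Bornology.IsBounded (Ω : Set (EuclideanSpace ℝ (Fin n)))) (hpq : p.HolderConjugate q)
    {f : EuclideanSpace ℝ (Fin n) → ℝ} (hf : MemLp f (ENNReal.ofReal q) (volume.restrict Ω))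
    {σ : ℝ} (hσ2 : σ ^ 2 = 1) (hσ : ∀ᵐ x ∂(volume.restrict Ω), 0 < σ * f x)
    {z : sobolevPairs Ω p}
    (hz : ∀ w, powFunctional p (gradOperator Ω p) (shift n 0) (loadFunctional hpq hf) z ≤
      powFunctional p (gradOperator Ω p) (shift n 0) (loadFunctional hpq hf) w)
    (φ : 𝓓(Ω, ℝ)) :
    ∫ x in Ω, (z.1.1 ⁻¹' {0}).indicator (fun x => σ * f x * |φ x|) x ≤ 0 := by
  set a := z.1.1
  set ℓ := integralPairing hpq hf
  set I := ∫ x in Ω, (a ⁻¹' {0}).indicator (fun x => σ * f x * |φ x|) x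
  have habs := abs_eq_sign_mul_of_minimizer hΩ hpq hf hσ2 hσ hz
  have hκ : MemLp (fun x => ‖gradient φ x‖) (ENNReal.ofReal p) (volume.restrict Ω) :=
    (TestFunction.memLp_gradient φ _).norm
  obtain ⟨C, r, hr, hC⟩ := exists_norm_augment_smul_rpow_le hpq.lt z.1.2 hκ.toLp
  have hmeas : MeasurableSet (a ⁻¹' {0}) :=
    (Lp.stronglyMeasurable a).measurable (measurableSet_singleton 0)
  have hIint : Integrable ((a ⁻¹' {0}).indicator fun x => σ * f x * |φ x|)
      (volume.restrict Ω) := by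
    refine Integrable.indicator ?_ hmeas
    refine ((integrable_mul_of_lp hpq hf |(testPair Ω p φ).1|).const_mul σ).congr ?_
    filter_upwards [Lp.coeFn_abs (testPair Ω p φ).1, testPair_fst_ae (p := p) φ] with x h1 h2
    rw [h1, h2]
    ring
  -- The competitor has `ψ = sφ` and `k' = s |∇φ|`. Its load gain is `s σ f |φ|` on `{u = 0}` and
  -- nonnegative elsewhere, its energy cost at most `C s ^ r / p`; dividing by `s` leaves a positive
  -- power of `s` on the right.
  have hmain : ∀ s : ℝ, 0 < s → s ≤ 1 → I ≤ 1 / p * C * s ^ (r - 1) := by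
    intro s hs hs1
    have h := powFunctional_le_of_minimizer hΩ hpq hf hσ2 hσ (k' := s • hκ.toLp) (s • φ) (by
      filter_upwards [Lp.coeFn_smul s hκ.toLp, hκ.coeFn_toLp,
        Lp.coeFn_zero ℝ (ENNReal.ofReal p)
          (volume.restrict (Ω : Set (EuclideanSpace ℝ (Fin n))))] with x h1 h2 h3
      rw [h1, Pi.smul_apply, h2, h3, TestFunction.gradient_smul, Pi.smul_apply, norm_smul,
        Real.norm_of_nonneg hs.le, smul_eq_mul]
      simp) hz
    rw [powFunctional, gradOperator_add_shift, loadFunctional_apply] at h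
    have h1 := mul_le_mul_of_nonneg_left (hC s hs hs1) (one_div_nonneg.2 hpq.nonneg)
    set w := |a| ⊔ |(testPair Ω p (s • φ)).1|
    have h2 : σ * ℓ w - ℓ a ≤ 1 / p * C * s ^ r := by
      rw [mul_add, ← mul_assoc] at h1
      linarith
    have h3 : s * I ≤ σ * ℓ w - ℓ a := by
      have i1 := (integrable_mul_of_lp hpq hf w).const_mul σ
      have i2 := integrable_mul_of_lp hpq hf a
      simp only [ℓ, integralPairing_eq_integral_mul]
      rw [← integral_const_mul, ← integral_const_mul, ← integral_sub i1 i2]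
      refine integral_mono_ae (hIint.const_mul s) (i1.sub i2) ?_
      filter_upwards [habs, hσ, Lp.coeFn_sup |a| |(testPair Ω p (s • φ)).1|, Lp.coeFn_abs a,
        Lp.coeFn_abs (testPair Ω p (s • φ)).1, testPair_fst_ae (p := p) (s • φ)]
        with x g1 g2 g3 g4 g5 g6
      have g7 : (s • φ : 𝓓(Ω, ℝ)) x = s * φ x := rfl
      rw [g3, Pi.sup_apply, g4, g5, g6, g7, abs_mul, abs_of_pos hs]
      have g8 : f x * a x = σ * f x * |a x| := by
        rw [g1]
        linear_combination (-(f x * a x)) * hσ2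
      rw [g8]
      by_cases hx : a x = 0
      · rw [Set.indicator_of_mem (show x ∈ a ⁻¹' {0} from hx), hx, abs_zero,
          sup_of_le_right (by positivity)]
        exact le_of_eq (by ring)
      · rw [Set.indicator_of_notMem (show x ∉ a ⁻¹' {0} from hx), mul_zero]
        have : |a x| ≤ |a x| ⊔ s * |φ x| := le_sup_left
        nlinarith
    have h4 : s * I ≤ s * (1 / p * C * s ^ (r - 1)) := by
      have : s ^ r = s * s ^ (r - 1) := by
        rw [Real.rpow_sub hs, Real.rpow_one]
        field_simp
      rw [this] at h2
      linarith
    exact le_of_mul_le_mul_left h4 hs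
  have hlim : Tendsto (fun s : ℝ => 1 / p * C * s ^ (r - 1)) (𝓝[>] 0) (𝓝 (1 / p * C * 0)) := by
    have h0 : Tendsto (fun s : ℝ => s ^ (r - 1)) (𝓝 0) (𝓝 ((0 : ℝ) ^ (r - 1))) :=
      (Real.continuous_rpow_const (by linarith)).tendsto 0
    rw [Real.zero_rpow (by linarith : r - 1 ≠ 0)] at h0
    exact (h0.mono_left nhdsWithin_le_nhds).const_mul _
  rw [mul_zero] at hlim
  refine ge_of_tendsto hlim ?_
  filter_upwards [self_mem_nhdsWithin, mem_nhdsWithin_of_mem_nhds (Iic_mem_nhds one_pos)]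
    with s hs hs1
  exact hmain s hs hs1

/-- A minimizer of the unregularized functional does not vanish. -/
lemma ne_zero_of_minimizer
    (hΩ : Bornology.IsBounded (Ω : Set (EuclideanSpace ℝ (Fin n)))) (hpq : p.HolderConjugate q)
    {f : EuclideanSpace ℝ (Fin n) → ℝ} (hf : MemLp f (ENNReal.ofReal q) (volume.restrict Ω))
    {σ : ℝ} (hσ2 : σ ^ 2 = 1) (hσ : ∀ᵐ x ∂(volume.restrict Ω), 0 < σ * f x)
    {z : sobolevPairs Ω p}
    (hz : ∀ w, powFunctional p (gradOperator Ω p) (shift n 0) (loadFunctional hpq hf) z ≤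
      powFunctional p (gradOperator Ω p) (shift n 0) (loadFunctional hpq hf) w) :
    ∀ᵐ x ∂(volume.restrict Ω), z.1.1 x ≠ 0 := by
  have hmeas : MeasurableSet (z.1.1 ⁻¹' {0}) :=
    (Lp.stronglyMeasurable z.1.1).measurable (measurableSet_singleton 0)
  have : Fact (1 ≤ ENNReal.ofReal q) := ⟨by simpa using hpq.symm.lt.le⟩
  have hg : MemLp ((z.1.1 ⁻¹' {0}).indicator fun x => σ * f x) (ENNReal.ofReal q)
      (volume.restrict Ω) := (hf.const_mul σ).indicator hmeas
  have key : ∀ᵐ x ∂volume, x ∈ (Ω : Set (EuclideanSpace ℝ (Fin n))) →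
      (z.1.1 ⁻¹' {0}).indicator (fun x => σ * f x) x = 0 := by
    -- The load restricted to the zero set is orthogonal to every test function, hence zero almost
    -- everywhere; as `σ f > 0`, the zero set is null.
    refine Ω.isOpen.ae_eq_zero_of_integral_contDiff_smul_eq_zero
      (locallyIntegrableOn_of_memLp hg) fun g hgd hgc hgs => ?_
    let φ : 𝓓(Ω, ℝ) := ⟨g, hgd, hgc, hgs⟩
    have h := integral_zeroSet_nonpos_of_minimizer hΩ hpq hf hσ2 hσ hz φ
    have hnn : 0 ≤ᵐ[volume.restrict Ω]
        (z.1.1 ⁻¹' {0}).indicator fun x => σ * f x * |φ x| := by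
      filter_upwards [hσ] with x hx
      exact Set.indicator_apply_nonneg fun _ => by positivity
    have hint : Integrable ((z.1.1 ⁻¹' {0}).indicator fun x => σ * f x * |φ x|)
        (volume.restrict Ω) := by
      refine Integrable.indicator ?_ hmeas
      refine ((integrable_mul_of_lp hpq hf |(testPair Ω p φ).1|).const_mul σ).congr ?_
      filter_upwards [Lp.coeFn_abs (testPair Ω p φ).1, testPair_fst_ae (p := p) φ] with x h1 h2
      rw [h1, h2]
      ring
    have h0 := (integral_eq_zero_iff_of_nonneg_ae hnn hint).1
      (le_antisymm h (integral_nonneg_of_ae hnn))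
    rw [← setIntegral_eq_integral_of_forall_compl_eq_zero (s := (Ω : Set _)) fun x hx => by
      rw [image_eq_zero_of_notMem_tsupport fun hx' => hx (hgs hx'), zero_smul]]
    refine integral_eq_zero_of_ae ?_
    filter_upwards [h0, hσ] with x h1 h2
    by_cases hx : x ∈ z.1.1 ⁻¹' {0}
    · rw [Set.indicator_of_mem hx, Pi.zero_apply, mul_eq_zero, abs_eq_zero] at h1
      have : g x = 0 := h1.resolve_left h2.ne'
      simp [this]
    · simp [Set.indicator_of_notMem hx]
  have key' : ∀ᵐ x ∂(volume.restrict (Ω : Set (EuclideanSpace ℝ (Fin n)))),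
      (z.1.1 ⁻¹' {0}).indicator (fun x => σ * f x) x = 0 :=
    (ae_restrict_iff' Ω.isOpen.measurableSet).2 key
  filter_upwards [key', hσ] with x h1 h2 hx
  rw [Set.indicator_of_mem (show x ∈ z.1.1 ⁻¹' {0} from hx)] at h1
  exact h2.ne' h1

end StrictSign

/-! ### Dependence of the energy on `ε` -/

section Regularization

variable [Fact (1 ≤ ENNReal.ofReal p)]

lemma pairEnergy_zero_le (hΩ : Bornology.IsBounded (Ω : Set (EuclideanSpace ℝ (Fin n))))
    (hpq : p.HolderConjugate q) {f : EuclideanSpace ℝ (Fin n) → ℝ}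
    (hf : MemLp f (ENNReal.ofReal q) (volume.restrict Ω)) (ε : ℝ) (z : sobolevPairs Ω p) :
    pairEnergy hΩ hpq hf 0 z ≤ pairEnergy hΩ hpq hf ε z := by
  simp only [pairEnergy, powFunctional, gradOperator_add_shift]
  refine sub_le_sub_right (mul_le_mul_of_nonneg_left (Real.rpow_le_rpow (norm_nonneg _)
    (norm_augment_mono ?_) hpq.nonneg) (one_div_nonneg.2 hpq.nonneg)) _
  filter_upwards [Lp.coeFn_smul (chi p * 0) (oneLp hΩ p)] with x h1
  rw [h1, Pi.smul_apply, mul_zero, zero_smul]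
  nlinarith [sq_nonneg (((chi p * ε) • oneLp hΩ p :
    Lp ℝ (ENNReal.ofReal p) (volume.restrict (Ω : Set (EuclideanSpace ℝ (Fin n))))) x)]

lemma continuous_pairEnergy_param (hΩ : Bornology.IsBounded (Ω : Set (EuclideanSpace ℝ (Fin n))))
    (hpq : p.HolderConjugate q) {f : EuclideanSpace ℝ (Fin n) → ℝ}
    (hf : MemLp f (ENNReal.ofReal q) (volume.restrict Ω)) (z : sobolevPairs Ω p) :
    Continuous fun ε : ℝ => pairEnergy hΩ hpq hf ε z := by
  simp only [pairEnergy, powFunctional, shift]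
  refine (continuous_const.mul (Continuous.rpow_const ?_ fun _ => Or.inr hpq.nonneg)).sub
    continuous_const
  fun_prop

end Regularization

end PLaplace

end

/-! ### Assembly: existence, uniqueness, sign and convergence -/

theorem theorem1p1 (n : ℕ) (hn : 1 ≤ n)
    (Ω : TopologicalSpace.Opens (EuclideanSpace ℝ (Fin n)))
    (hΩ_conn : IsConnected (Ω : Set (EuclideanSpace ℝ (Fin n))))
    (hΩ_bdd : Bornology.IsBounded (Ω : Set (EuclideanSpace ℝ (Fin n))))
    (p q : ℝ) (hp1 : 1 < p) (hp2 : p ≠ 2) (hpq : 1 / p + 1 / q = 1)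
    (f : EuclideanSpace ℝ (Fin n) → ℝ)
    (hf : MemLp f (ENNReal.ofReal q) (volume.restrict Ω))
    (hsgn : (∀ᵐ x ∂(volume.restrict Ω), 0 < f x) ∨ (∀ᵐ x ∂(volume.restrict Ω), f x < 0)) :
    ∃ ubar : EuclideanSpace ℝ (Fin n) → ℝ,
      PLaplace.IsMinimizer Ω p (PLaplace.energy Ω p f) ubar ∧
      (∀ v, PLaplace.IsMinimizer Ω p (PLaplace.energy Ω p f) v →
        v =ᵐ[volume.restrict Ω] ubar) ∧
      ((∀ᵐ x ∂(volume.restrict Ω), 0 < f x) → ∀ᵐ x ∂(volume.restrict Ω), 0 < ubar x) ∧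
      ((∀ᵐ x ∂(volume.restrict Ω), f x < 0) → ∀ᵐ x ∂(volume.restrict Ω), ubar x < 0) ∧
      ∃ u : ℝ → EuclideanSpace ℝ (Fin n) → ℝ,
        (∀ ε : ℝ, 0 < ε →
          PLaplace.IsMinimizer Ω p (PLaplace.regEnergy Ω ε p f) (u ε) ∧
          ((∀ᵐ x ∂(volume.restrict Ω), 0 < f x) → ∀ᵐ x ∂(volume.restrict Ω), 0 ≤ u ε x) ∧
          ((∀ᵐ x ∂(volume.restrict Ω), f x < 0) → ∀ᵐ x ∂(volume.restrict Ω), u ε x ≤ 0)) ∧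
        Tendsto (fun ε : ℝ => PLaplace.W1pNorm Ω p (u ε - ubar)) (𝓝[>] 0) (𝓝 0) := by
  open PLaplace in
  have hc : p.HolderConjugate q := Real.holderConjugate_iff.2 ⟨hp1, by simpa using hpq⟩
  have : Fact (1 ≤ ENNReal.ofReal p) := ⟨by simpa using hp1.le⟩
  obtain ⟨C, hC, hA⟩ := exists_norm_le_gradOperator hc hn hΩ_bdd
  have hY : PowUniformConvex (Lp (Augmented n) (ENNReal.ofReal p)
      (volume.restrict (Ω : Set (EuclideanSpace ℝ (Fin n))))) p :=
    (powUniformConvex_of_finiteDimensional hp1).lp hp1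
  -- One family of minimizers is chosen for all real `ε`; its member at `0` serves as `ubar`.
  have hex : ∀ ε : ℝ, ∃ z, ∀ w, pairEnergy hΩ_bdd hc hf ε z ≤ pairEnergy hΩ_bdd hc hf ε w :=
    fun ε => exists_powFunctional_minimizer hp1 hY hC hA _ _
  choose z hz using hex
  have hmem : ∀ ε, ⇑(z ε).1.1 ∈ W01p Ω p := fun ε => mem_W01p_of_mem hc (z ε).2
  have henergy : energy Ω p f = regEnergy Ω 0 p f := funext (energy_eq_regEnergy_zero f)
  have hmin : ∀ ε, IsMinimizer Ω p (regEnergy Ω ε p f) (z ε).1.1 := fun ε => by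
    rw [isMinimizer_regEnergy_iff hΩ_bdd hc hf ε (hmem ε), toSobolevPairs_coe hc]
    exact hz ε
  have hpos : (∀ᵐ x ∂(volume.restrict Ω), 0 < f x) →
      ∀ᵐ x ∂(volume.restrict Ω), 0 < 1 * f x := fun h => by simpa using h
  have hneg : (∀ᵐ x ∂(volume.restrict Ω), f x < 0) →
      ∀ᵐ x ∂(volume.restrict Ω), 0 < -1 * f x := fun h => by simpa using h
  have hle : (∀ᵐ x ∂(volume.restrict Ω), 0 < f x) →
      ∀ ε, ∀ᵐ x ∂(volume.restrict Ω), 0 ≤ (z ε).1.1 x := fun h ε => by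
    filter_upwards [abs_eq_sign_mul_of_minimizer hΩ_bdd hc hf (one_pow 2) (hpos h) (hz ε)]
      with x hx
    linarith [abs_nonneg ((z ε).1.1 x)]
  have hge : (∀ᵐ x ∂(volume.restrict Ω), f x < 0) →
      ∀ ε, ∀ᵐ x ∂(volume.restrict Ω), (z ε).1.1 x ≤ 0 := fun h ε => by
    filter_upwards [abs_eq_sign_mul_of_minimizer hΩ_bdd hc hf (by norm_num : (-1 : ℝ) ^ 2 = 1)
      (hneg h) (hz ε)] with x hx
    linarith [abs_nonneg ((z ε).1.1 x)]
  have hz0 : ∀ w, powFunctional p (gradOperator Ω p) (shift n 0) (loadFunctional hc hf) (z 0) ≤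
      powFunctional p (gradOperator Ω p) (shift n 0) (loadFunctional hc hf) w := fun w => by
    simpa only [pairEnergy, mul_zero, zero_smul] using hz 0 w
  refine ⟨(z 0).1.1, ?_, fun v hv => ?_, fun h => ?_, fun h => ?_, fun ε => (z ε).1.1,
    fun ε _ => ⟨hmin ε, fun h => hle h ε, fun h => hge h ε⟩, ?_⟩
  · rw [henergy]
    exact hmin 0
  · rw [henergy] at hv
    have h1 := powFunctional_minimizer_unique hp1 hY hC hA _ _ (hz 0)
      ((isMinimizer_regEnergy_iff hΩ_bdd hc hf 0 hv.1).1 hv)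
    rw [← h1]
    exact (toSobolevPairs_fst_ae hv.1).symm
  · filter_upwards [hle h 0, ne_zero_of_minimizer hΩ_bdd hc hf (one_pow 2) (hpos h) hz0]
      with x h1 h2
    exact lt_of_le_of_ne h1 h2.symm
  · filter_upwards [hge h 0, ne_zero_of_minimizer hΩ_bdd hc hf
      (by norm_num : (-1 : ℝ) ^ 2 = 1) (hneg h) hz0] with x h1 h2
    exact lt_of_le_of_ne h1 h2
  · have hJ : Tendsto (fun ε => pairEnergy hΩ_bdd hc hf 0 (z ε)) (𝓝[>] 0)
        (𝓝 (pairEnergy hΩ_bdd hc hf 0 (z 0))) :=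
      tendsto_of_tendsto_of_tendsto_of_le_of_le tendsto_const_nhds
        (((continuous_pairEnergy_param hΩ_bdd hc hf (z 0)).tendsto 0).mono_left nhdsWithin_le_nhds)
        (fun ε => hz 0 (z ε))
        (fun ε => (pairEnergy_zero_le hΩ_bdd hc hf ε (z ε)).trans (hz ε (z 0)))
    have hlim : Tendsto z (𝓝[>] 0) (𝓝 (z 0)) :=
      powFunctional_tendsto_of_minimizing hp1 hY hC hA _ _ (hz 0) hJ
    have hval := (continuous_subtype_val.tendsto _).comp hlim
    have t1 := tendsto_iff_edist_tendsto_0.1 ((continuous_fst.tendsto _).comp hval)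
    have t2 := tendsto_iff_edist_tendsto_0.1 ((continuous_snd.tendsto _).comp hval)
    simpa only [W1pNorm_sub_eq_of_mem hc, Function.comp_apply, add_zero] using t1.add t2
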